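/- Let $(M,g)$ be a (pseudo-)Riemannian manifold with Levi-Civita connection $\nabla$, and let $S\to M$ be a (real or complex, possibly twisted) spinor bundle, or more generally any smooth vector bundle with a smooth Clifford multiplication $\gamma:TM\to\mathrm{End}(S)$, $XY+YX=-2g(X,Y)$, together with a charge conjugation $C$, i.e. a smooth nondegenerate bilinear form on $S$ with $C(\varphi,\psi)=\Delta_0C(\psi,\varphi)$ and $C(\varphi,X\psi)=\Delta_1C(\psi,X\varphi)$ for fixed signs $\Delta_0,\Delta_1\in\{\pm1\}$. Let $D$ be a smooth connection on $S$ with curvature $R$, and let $D^C$ be the connection on $S$ determined by $X(C(\varphi,\psi))=C(D_X\varphi,\psi)+C(\varphi,D^C_X\psi)$. Put $(\hat D_X\gamma)(Y)\xi=D_X(Y\xi)-(\nabla_XY)\xi-Y\,D^C_X\xi$ and let $\mathcal T(X,Y)=(\hat D_X\gamma)(Y)-(\hat D_Y\gamma)(X)$ be the torsion of $D$. For a local frame $e_\mu$ with $g$-dual frame $e^\mu$ write $\gamma^\mu=\gamma(e^\mu)$, $R_{\mu\nu}=R(e_\mu,e_\nu)$, $\mathcal T_{\mu\nu}=\mathcal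 T(e_\mu,e_\nu)$, and for spinor fields $\varphi,\psi$ set $$\mathfrak B(R;\varphi,\psi)=\gamma^\mu\varphi\wedge\gamma^\nu\psi\wedge R_{\mu\nu}\in\Gamma\,\mathrm{Hom}(S,\Lambda^3S),$$ $$\mathfrak D(\mathcal T;\varphi,\psi)=\big(\gamma^\mu\varphi\wedge\mathcal T_{\mu\nu}\psi+\gamma^\mu\psi\wedge\mathcal T_{\mu\nu}\varphi\big)\otimes e^\nu\in\Gamma(\Lambda^2S\otimes TM).$$ Let $\eta$ be a smooth section of $S$ with $D^C\eta=0$ such that $(D,\{\eta\})$ is admissible, i.e. $(\hat D_X\gamma)(Y)\eta+(\hat D_Y\gamma)(X)\eta=0$ for all $X,Y$. Then there is exactly one odd vector field $\imath(\eta)=\gamma^\mu\eta\otimes D_\mu$ on the graded manifold $(M,\Gamma\Lambda S)$, i.e. exactly one odd superderivation of $\Gamma\Lambda S$ with $$\imath(\eta)f=df(e_\mu)\,\gamma^\mu\eta\quad(f\in C^\infty(M)),\qquad \imath(\eta)\psi=\gamma^\mu\eta\wedge D_{e_\mu}\psi\quad(\psi\in\Gamma S),$$ and it is a differential, $\imath(\eta)\circ\imath(\eta)=0$,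 if and only if $(D,\{\eta\})$ is flat, i.e. $\mathfrak B(R;\eta,\eta)=0$ and $\mathfrak D(\mathcal T;\eta,\eta)=0$. -/

import Mathlib

open Bundle Manifold
open scoped ContDiff Topology TensorProduct

set_option linter.unusedSectionVars false

noncomputable section

namespace SpinSuper

section Geometry

variable {E : Type*} [NormedAddCommGroup E] [NormedSpace ℝ E] [FiniteDimensional ℝ E]
  {M : Type*} [TopologicalSpace M] [ChartedSpace E M] [IsManifold 𝓘(ℝ, E) ∞ M]

/-- A smooth pseudo-Riemannian metric on `M`: a smooth family of symmetric nondegenerate bilinear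
forms on the tangent spaces, of arbitrary signature. -/
structure PseudoRiemannianMetric (E : Type*) [NormedAddCommGroup E] [NormedSpace ℝ E]
    (M : Type*) [TopologicalSpace M] [ChartedSpace E M] [IsManifold 𝓘(ℝ, E) ∞ M] where
  /-- The bilinear form `g x` on `T_x M`. -/
  val (x : M) : TangentSpace 𝓘(ℝ, E) x →L[ℝ] TangentSpace 𝓘(ℝ, E) x →L[ℝ] ℝ
  symm (x : M) (v w : TangentSpace 𝓘(ℝ, E) x) : val x v w = val x w v
  nondegenerate (x : M) (v : TangentSpace 𝓘(ℝ, E) x) (hv : ∀ w, val x v w = 0) : v = 0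
  contMDiff : ContMDiff 𝓘(ℝ, E) (𝓘(ℝ, E).prod 𝓘(ℝ, E →L[ℝ] E →L[ℝ] ℝ)) ∞
    (fun x ↦ TotalSpace.mk' (E →L[ℝ] E →L[ℝ] ℝ) x (val x))

namespace PseudoRiemannianMetric

variable (g : PseudoRiemannianMetric E M)

/-- The form `g x` as an algebraic bilinear form. -/
def bilin (x : M) : LinearMap.BilinForm ℝ (TangentSpace 𝓘(ℝ, E) x) :=
  LinearMap.mk₂ ℝ (fun v w ↦ g.val x v w) (by simp) (by simp) (by simp) (by simp)

theorem bilin_nondegenerate (x : M) : (g.bilin x).Nondegenerate := by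
  constructor
  · intro v hv
    exact g.nondegenerate x v hv
  · intro v hv
    exact g.nondegenerate x v (fun w ↦ (g.symm x v w).trans (hv w))

/-- A basis `e_μ` of `T_x M`. -/
def frame (x : M) : Module.Basis (Fin (Module.finrank ℝ E)) ℝ (TangentSpace 𝓘(ℝ, E) x) :=
  Module.finBasis ℝ E

/-- The dual basis `e^μ` of `T_x M`: `g(e^μ, e_ν) = δ^μ_ν`. -/
def coframe (x : M) : Module.Basis (Fin (Module.finrank ℝ E)) ℝ (TangentSpace 𝓘(ℝ, E) x) :=
  (g.bilin x).dualBasis (g.bilin_nondegenerate x) (frame x)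

/-- The metric contraction `∑_μ f(e^μ, e_μ)`. For bilinear `f`, the only case in which it is used,
it does not depend on the basis `e_μ`. -/
def contract {W : Type*} [AddCommMonoid W] (x : M)
    (f : TangentSpace 𝓘(ℝ, E) x → TangentSpace 𝓘(ℝ, E) x → W) : W :=
  ∑ μ, f (g.coframe x μ) (frame x μ)

/-- `∇` is the Levi-Civita connection of `g`: it is torsion free and metric. -/
def IsLeviCivita (nabla : CovariantDerivative 𝓘(ℝ, E) E (TangentSpace 𝓘(ℝ, E) : M → Type _)) :
    Prop :=
  (∀ (X Y : Π x : M, TangentSpace 𝓘(ℝ, E) x) (x : M), MDiffAt (T% X) x → MDiffAt (T% Y) x →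
    nabla Y x (X x) - nabla X x (Y x) = VectorField.mlieBracket 𝓘(ℝ, E) X Y x) ∧
  (∀ (Y Z : Π x : M, TangentSpace 𝓘(ℝ, E) x) (x : M), MDiffAt (T% Y) x → MDiffAt (T% Z) x →
    ∀ v : TangentSpace 𝓘(ℝ, E) x,
      mvfderiv 𝓘(ℝ, E) (fun y ↦ g.val y (Y y) (Z y)) x v
        = g.val x (nabla Y x v) (Z x) + g.val x (Y x) (nabla Z x v))

end PseudoRiemannianMetric

end Geometry

section Spinors

variable {𝕜 : Type*} [RCLike 𝕜]
  {E : Type*} [NormedAddCommGroup E] [NormedSpace ℝ E] [FiniteDimensional ℝ E]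
  {M : Type*} [TopologicalSpace M] [ChartedSpace E M] [IsManifold 𝓘(ℝ, E) ∞ M]
  {F : Type*} [NormedAddCommGroup F] [NormedSpace ℝ F] [NormedSpace 𝕜 F] [IsScalarTower ℝ 𝕜 F]
  [FiniteDimensional ℝ F]
  {S : M → Type*} [TopologicalSpace (TotalSpace F S)]
  [∀ x, AddCommGroup (S x)] [∀ x, Module ℝ (S x)] [∀ x, Module 𝕜 (S x)]
  [∀ x, IsScalarTower ℝ 𝕜 (S x)]
  [∀ x, TopologicalSpace (S x)] [∀ x, IsTopologicalAddGroup (S x)] [∀ x, ContinuousSMul ℝ (S x)]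
  [FiberBundle F S] [VectorBundle ℝ F S] [VectorBundle 𝕜 F S]
  [ContMDiffVectorBundle ∞ F S 𝓘(ℝ, E)]

/-- A Clifford multiplication `γ : TM → End(S)` on a bundle `S` of `𝕜`-vector spaces, with the sign
convention `XY + YX = -2 g(X,Y)`. The spinor bundle of a spin manifold, and every twisted spinor
bundle, is a bundle `S` with such a multiplication; irreducibility of the fibres is not required. -/
structure CliffordMultiplication (𝕜 : Type*) [RCLike 𝕜]
    {E : Type*} [NormedAddCommGroup E] [NormedSpace ℝ E] [FiniteDimensional ℝ E]
    {M : Type*} [TopologicalSpace M] [ChartedSpace E M] [IsManifold 𝓘(ℝ, E) ∞ M]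
    (g : PseudoRiemannianMetric E M)
    (F : Type*) [NormedAddCommGroup F] [NormedSpace ℝ F]
    (S : M → Type*) [TopologicalSpace (TotalSpace F S)]
    [∀ x, AddCommGroup (S x)] [∀ x, Module ℝ (S x)] [∀ x, Module 𝕜 (S x)]
    [∀ x, TopologicalSpace (S x)] [∀ x, IsTopologicalAddGroup (S x)] [∀ x, ContinuousSMul ℝ (S x)]
    [FiberBundle F S] [VectorBundle ℝ F S] where
  /-- `mul x v s` is the Clifford product `v · s`. -/
  mul (x : M) : TangentSpace 𝓘(ℝ, E) x →L[ℝ] S x →L[ℝ] S x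
  mul_smul (x : M) (v : TangentSpace 𝓘(ℝ, E) x) (c : 𝕜) (s : S x) :
    mul x v (c • s) = c • mul x v s
  clifford (x : M) (v w : TangentSpace 𝓘(ℝ, E) x) (s : S x) :
    mul x v (mul x w s) + mul x w (mul x v s) = (-2 * g.val x v w) • s
  contMDiff : ContMDiff 𝓘(ℝ, E) (𝓘(ℝ, E).prod 𝓘(ℝ, E →L[ℝ] F →L[ℝ] F)) ∞
    (fun x ↦ TotalSpace.mk' (E →L[ℝ] F →L[ℝ] F) x (mul x))

/-- A charge conjugation: a smooth nondegenerate `𝕜`-bilinear form `C` on `S` for which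
`C(φ, ψ) = Δ₀ C(ψ, φ)` and `C(φ, Xψ) = Δ₁ C(ψ, Xφ)` with signs `Δ₀, Δ₁ ∈ {1, -1}`
(so that `C` is spin-invariant). -/
structure ChargeConjugation {g : PseudoRiemannianMetric E M}
    (γ : CliffordMultiplication 𝕜 g F S) where
  /-- The bilinear form on the fibre `S x`. -/
  form (x : M) : S x →L[ℝ] S x →L[ℝ] 𝕜
  smul_left (x : M) (c : 𝕜) (φ ψ : S x) : form x (c • φ) ψ = c * form x φ ψ
  smul_right (x : M) (c : 𝕜) (φ ψ : S x) : form x φ (c • ψ) = c * form x φ ψ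
  nondegenerate (x : M) (φ : S x) (hφ : ∀ ψ, form x φ ψ = 0) : φ = 0
  /-- The sign `Δ₀`. -/
  Δ₀ : ℤˣ
  /-- The sign `Δ₁`. -/
  Δ₁ : ℤˣ
  symm (x : M) (φ ψ : S x) : form x φ ψ = ((Δ₀ : ℤ) : 𝕜) * form x ψ φ
  symm_mul (x : M) (v : TangentSpace 𝓘(ℝ, E) x) (φ ψ : S x) :
    form x φ (γ.mul x v ψ) = ((Δ₁ : ℤ) : 𝕜) * form x ψ (γ.mul x v φ)
  contMDiff : ContMDiff 𝓘(ℝ, E) (𝓘(ℝ, E).prod 𝓘(ℝ, F →L[ℝ] F →L[ℝ] 𝕜)) ∞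
    (fun x ↦ TotalSpace.mk' (F →L[ℝ] F →L[ℝ] 𝕜) x (form x))

/-- A (smooth, `𝕜`-linear) connection on the bundle `S`; `D ψ x v` is `D_v ψ` at `x`. -/
structure SpinorConnection (𝕜 : Type*) [RCLike 𝕜]
    (E : Type*) [NormedAddCommGroup E] [NormedSpace ℝ E]
    {M : Type*} [TopologicalSpace M] [ChartedSpace E M] [IsManifold 𝓘(ℝ, E) ∞ M]
    (F : Type*) [NormedAddCommGroup F] [NormedSpace ℝ F]
    (S : M → Type*) [TopologicalSpace (TotalSpace F S)]
    [∀ x, AddCommGroup (S x)] [∀ x, Module ℝ (S x)] [∀ x, Module 𝕜 (S x)]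
    [∀ x, TopologicalSpace (S x)] [∀ x, IsTopologicalAddGroup (S x)] [∀ x, ContinuousSMul ℝ (S x)]
    [FiberBundle F S] [VectorBundle ℝ F S] extends CovariantDerivative 𝓘(ℝ, E) F S where
  map_const_smul {σ : Π x : M, S x} {x : M} (c : 𝕜) (hσ : MDiffAt (T% σ) x)
    (v : TangentSpace 𝓘(ℝ, E) x) :
    toFun (fun y ↦ c • σ y) x v = c • toFun σ x v
  smooth : CovariantDerivative.ContMDiffCovariantDerivative toCovariantDerivative ∞

namespace ChargeConjugation

variable {g : PseudoRiemannianMetric E M} {γ : CliffordMultiplication 𝕜 g F S}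
  (C : ChargeConjugation γ)

theorem mdifferentiableAt_form {φ ψ : Π x : M, S x} {x : M} (hφ : MDiffAt (T% φ) x)
    (hψ : MDiffAt (T% ψ) x) :
    MDifferentiableAt 𝓘(ℝ, E) 𝓘(ℝ, 𝕜) (fun y ↦ C.form y (φ y) (ψ y)) x := by
  have : MDifferentiableAt 𝓘(ℝ, E) (𝓘(ℝ, E).prod 𝓘(ℝ, 𝕜))
      (fun m ↦ TotalSpace.mk' 𝕜 (E := Bundle.Trivial M 𝕜) m (C.form m (φ m) (ψ m))) x := by
    apply MDifferentiableAt.clm_bundle_apply₂ (F₁ := F) (F₂ := F)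
    · exact C.contMDiff.contMDiffAt.mdifferentiableAt (by simp)
    · exact hφ
    · exact hψ
  simp only [mdifferentiableAt_totalSpace] at this
  exact this.2

/-- The functional `φ ↦ v(C(φ, ψ)) - C(D_v φ, ψ)` of sections `φ`. -/
def conjFunctional (D : SpinorConnection 𝕜 E F S) (ψ : Π x : M, S x) (x : M)
    (v : TangentSpace 𝓘(ℝ, E) x) (φ : Π x : M, S x) : 𝕜 :=
  mvfderiv 𝓘(ℝ, E) (fun y ↦ C.form y (φ y) (ψ y)) x v - C.form x (D.toFun φ x v) (ψ x)

theorem tensorialAt_conjFunctional (D : SpinorConnection 𝕜 E F S) {ψ : Π x : M, S x} {x : M}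
    (hψ : MDiffAt (T% ψ) x) (v : TangentSpace 𝓘(ℝ, E) x) :
    TensorialAt 𝓘(ℝ, E) F (C.conjFunctional D ψ x v) x where
  smul {f σ} hf hσ := by
    have h1 := mvfderiv_smul hf (C.mdifferentiableAt_form hσ hψ)
    have h2 : (fun y ↦ C.form y ((f • σ) y) (ψ y))
        = f • (fun y ↦ C.form y (σ y) (ψ y)) := by
      ext y; simp
    have h3 := D.isCovariantDerivativeOnUniv.leibniz hσ hf
    simp only [conjFunctional, h2, h1, h3]
    simp [smul_sub]
  add {σ σ'} hσ hσ' := by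
    have h1 := mvfderiv_add (C.mdifferentiableAt_form hσ hψ) (C.mdifferentiableAt_form hσ' hψ)
    have h2 : (fun y ↦ C.form y ((σ + σ') y) (ψ y))
        = (fun y ↦ C.form y (σ y) (ψ y)) + (fun y ↦ C.form y (σ' y) (ψ y)) := by
      ext y; simp
    have h3 := D.isCovariantDerivativeOnUniv.add hσ hσ'
    simp only [conjFunctional, h2, h1, h3]
    simp
    ring

/-- Two spinors with the same pairings coincide. -/
theorem ext_right {x : M} {s t : S x} (h : ∀ φ, C.form x φ s = C.form x φ t) : s = t := by
  rw [← sub_eq_zero]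
  refine C.nondegenerate x _ fun φ ↦ ?_
  rw [C.symm, map_sub, h, sub_self, mul_zero]

/-- Every `𝕜`-linear functional on `S x` is of the form `C(·, s)`. -/
theorem exists_form_eq (x : M) (ℓ : S x →ₗ[𝕜] 𝕜) : ∃ s, ∀ φ, C.form x φ s = ℓ φ := by
  have : FiniteDimensional ℝ (S x) := VectorBundle.finiteDimensional ℝ F S x
  have : FiniteDimensional 𝕜 (S x) := Module.Finite.of_restrictScalars_finite ℝ 𝕜 (S x)
  let T : S x →ₗ[𝕜] Module.Dual 𝕜 (S x) := LinearMap.mk₂ 𝕜 (fun s φ ↦ C.form x φ s)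
    (fun s t φ ↦ map_add _ _ _) (fun c s φ ↦ C.smul_right x c φ s)
    (fun s φ ψ ↦ by simp) (fun c s φ ↦ C.smul_left x c φ s)
  have hT : Function.Injective T := fun s t h ↦ C.ext_right fun φ ↦ congrArg (fun L ↦ L φ) h
  obtain ⟨s, hs⟩ := (LinearMap.injective_iff_surjective_of_finrank_eq_finrank
    (Subspace.dual_finrank_eq (K := 𝕜) (V := S x)).symm).1 hT ℓ
  exact ⟨s, fun φ ↦ congrArg (fun L ↦ L φ) hs⟩

theorem exists_conj (D : SpinorConnection 𝕜 E F S) {ψ : Π x : M, S x} {x : M}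
    (hψ : MDiffAt (T% ψ) x) :
    ∃ L : TangentSpace 𝓘(ℝ, E) x →L[ℝ] S x, ∀ (φ : Π x : M, S x), MDiffAt (T% φ) x →
      ∀ v, mvfderiv 𝓘(ℝ, E) (fun y ↦ C.form y (φ y) (ψ y)) x v
        = C.form x (D.toFun φ x v) (ψ x) + C.form x (φ x) (L v) := by
  have hconst (c : 𝕜) (φ : Π x : M, S x) (hφ : MDiffAt (T% φ) x) :
      MDiffAt (T% (fun y ↦ c • φ y)) x := by
    rw [mdifferentiableAt_totalSpace] at hφ ⊢
    refine ⟨hφ.1, ?_⟩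
    have h1 : MDifferentiableAt 𝓘(ℝ, E) 𝓘(ℝ, F)
        (fun y ↦ c • (trivializationAt F S x ⟨y, φ y⟩).2) x :=
      ((c • ContinuousLinearMap.id ℝ F).mdifferentiableAt).comp x hφ.2
    refine h1.congr_of_eventuallyEq ?_
    filter_upwards [(trivializationAt F S x).open_baseSet.mem_nhds
      (FiberBundle.mem_baseSet_trivializationAt' x)] with y hy
    exact ((trivializationAt F S x).linear 𝕜 hy).map_smul c (φ y)
  have key (v : TangentSpace 𝓘(ℝ, E) x) : ∃ s : S x, ∀ (φ : Π x : M, S x), MDiffAt (T% φ) x →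
      C.form x (φ x) s = C.conjFunctional D ψ x v φ := by
    have hten := C.tensorialAt_conjFunctional D hψ v
    let ℓ : S x →ₗ[𝕜] 𝕜 :=
      { toFun := TensorialAt.mkHom _ x hten
        map_add' := map_add _
        map_smul' := fun c s ↦ by
          have h0 := FiberBundle.mdifferentiableAt_extend 𝓘(ℝ, E) F s
          have h1 := TensorialAt.mkHom_apply hten (hconst c _ h0)
          have h2 := TensorialAt.mkHom_apply hten h0
          simp only [FiberBundle.extend_apply_self] at h1 h2
          rw [h1, h2]
          simp only [conjFunctional, D.map_const_smul c h0, C.smul_left]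
          have h3 : (fun y ↦ c * C.form y (FiberBundle.extend F s y) (ψ y))
              = c • (fun y ↦ C.form y (FiberBundle.extend F s y) (ψ y)) := rfl
          have h4 := C.mdifferentiableAt_form h0 hψ
          have h5 : mvfderiv 𝓘(ℝ, E)
              (c • (fun y ↦ C.form y (FiberBundle.extend F s y) (ψ y))) x v
              = c * mvfderiv 𝓘(ℝ, E)
                (fun y ↦ C.form y (FiberBundle.extend F s y) (ψ y)) x v := by
            have h6 := ((c • ContinuousLinearMap.id ℝ 𝕜).hasMFDerivAt).comp x h4.hasMFDerivAt
            exact congrArg (fun L ↦ L v) h6.mfderiv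
          rw [h3, h5, RingHom.id_apply, smul_eq_mul, mul_sub] }
    obtain ⟨s, hs⟩ := C.exists_form_eq x ℓ
    exact ⟨s, fun φ hφ ↦ (hs _).trans (TensorialAt.mkHom_apply hten hφ)⟩
  choose s hs using key
  have : FiniteDimensional ℝ (TangentSpace 𝓘(ℝ, E) x) := inferInstanceAs (FiniteDimensional ℝ E)
  have : T2Space (TangentSpace 𝓘(ℝ, E) x) := inferInstanceAs (T2Space E)
  let L : TangentSpace 𝓘(ℝ, E) x →ₗ[ℝ] S x :=
    { toFun := s
      map_add' := fun v w ↦ C.ext_right fun φ ↦ by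
        have h0 := FiberBundle.mdifferentiableAt_extend 𝓘(ℝ, E) F φ
        have h1 := hs v _ h0
        have h2 := hs w _ h0
        have h3 := hs (v + w) _ h0
        simp only [FiberBundle.extend_apply_self, conjFunctional, map_add] at h1 h2 h3
        rw [map_add, h1, h2, h3]
        simp
        ring
      map_smul' := fun c v ↦ C.ext_right fun φ ↦ by
        have h0 := FiberBundle.mdifferentiableAt_extend 𝓘(ℝ, E) F φ
        have h1 := hs v _ h0
        have h3 := hs (c • v) _ h0
        simp only [FiberBundle.extend_apply_self, conjFunctional, map_smul] at h1 h3
        rw [RingHom.id_apply, map_smul, h1, h3]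
        simp [smul_sub] }
  refine ⟨LinearMap.toContinuousLinearMap L, fun φ hφ v ↦ ?_⟩
  have := hs v φ hφ
  simp only [conjFunctional] at this
  change _ = _ + C.form x (φ x) (s v)
  rw [this]
  ring

open Classical in
/-- The connection `D^C`: it is determined by the requirement that `D ⊗ 1 + 1 ⊗ D^C` makes the
charge conjugation parallel, i.e. `v(C(φ, ψ)) = C(D_v φ, ψ) + C(φ, D^C_v ψ)`. -/
def conj (D : SpinorConnection 𝕜 E F S) : CovariantDerivative 𝓘(ℝ, E) F S where
  toFun ψ x := if hψ : MDiffAt (T% ψ) x then (C.exists_conj D hψ).choose else 0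
  isCovariantDerivativeOnUniv :=
    { add := fun {ψ ψ' x} hψ hψ' _ ↦ by
        have hadd : MDiffAt (T% (ψ + ψ')) x := mdifferentiableAt_add_section hψ hψ'
        rw [dif_pos hψ, dif_pos hψ', dif_pos hadd]
        ext v
        refine C.ext_right fun φ ↦ ?_
        have h0 := FiberBundle.mdifferentiableAt_extend 𝓘(ℝ, E) F φ
        have h1 := (C.exists_conj D hψ).choose_spec _ h0 v
        have h2 := (C.exists_conj D hψ').choose_spec _ h0 v
        have h3 := (C.exists_conj D hadd).choose_spec _ h0 v
        have h4 := mvfderiv_add (C.mdifferentiableAt_form h0 hψ) (C.mdifferentiableAt_form h0 hψ')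
        have h5 : (fun y ↦ C.form y (FiberBundle.extend F φ y) ((ψ + ψ') y))
            = (fun y ↦ C.form y (FiberBundle.extend F φ y) (ψ y))
              + (fun y ↦ C.form y (FiberBundle.extend F φ y) (ψ' y)) := by
          ext y; simp
        rw [h5, h4] at h3
        simp only [add_apply, Pi.add_apply, map_add,
          FiberBundle.extend_apply_self] at h1 h2 h3 ⊢
        rw [h1, h2] at h3
        linear_combination -h3
      leibniz := fun {ψ f x} hψ hf _ ↦ by
        have hsm : MDiffAt (T% (f • ψ)) x := hf.smul_section hψ
        rw [dif_pos hψ, dif_pos hsm]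
        ext v
        refine C.ext_right fun φ ↦ ?_
        have h0 := FiberBundle.mdifferentiableAt_extend 𝓘(ℝ, E) F φ
        have h1 := (C.exists_conj D hψ).choose_spec _ h0 v
        have h3 := (C.exists_conj D hsm).choose_spec _ h0 v
        have h4 := mvfderiv_smul hf (C.mdifferentiableAt_form h0 hψ)
        have h5 : (fun y ↦ C.form y (FiberBundle.extend F φ y) ((f • ψ) y))
            = f • (fun y ↦ C.form y (FiberBundle.extend F φ y) (ψ y)) := by
          ext y; simp
        rw [h5, h4] at h3
        simp only [add_apply, smul_apply,
          ContinuousLinearMap.smulRight_apply, Pi.smul_apply', map_add, map_smul, h1,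
          FiberBundle.extend_apply_self, smul_add] at h1 h3 ⊢
        linear_combination -h3 }

theorem mvfderiv_form (D : SpinorConnection 𝕜 E F S) {φ ψ : Π x : M, S x} {x : M}
    (hφ : MDiffAt (T% φ) x) (hψ : MDiffAt (T% ψ) x) (v : TangentSpace 𝓘(ℝ, E) x) :
    mvfderiv 𝓘(ℝ, E) (fun y ↦ C.form y (φ y) (ψ y)) x v
      = C.form x (D.toFun φ x v) (ψ x) + C.form x (φ x) (C.conj D ψ x v) := by
  have h := (C.exists_conj D hψ).choose_spec φ hφ v
  have h2 : C.conj D ψ x = (C.exists_conj D hψ).choose := dif_pos hψ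
  rw [h, h2]

end ChargeConjugation

section Tensors

variable {g : PseudoRiemannianMetric E M} {γ : CliffordMultiplication 𝕜 g F S}

/-- The curvature `R(v, w) s = D_v D_w s - D_w D_v s - D_{[v, w]} s` of `D`, computed with the
local smooth extensions of `v`, `w`, `s` which are constant in a trivialization (as `R` is
tensorial, every choice of smooth extensions gives the same value). -/
def curvature (D : SpinorConnection 𝕜 E F S) (x : M) (v w : TangentSpace 𝓘(ℝ, E) x) (s : S x) :
    S x :=
  D.toFun (fun y ↦ D.toFun (FiberBundle.extend F s) y (FiberBundle.extend E w y)) x v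
    - D.toFun (fun y ↦ D.toFun (FiberBundle.extend F s) y (FiberBundle.extend E v y)) x w
    - D.toFun (FiberBundle.extend F s) x
        (VectorField.mlieBracket 𝓘(ℝ, E) (FiberBundle.extend E v) (FiberBundle.extend E w) x)

variable (C : ChargeConjugation γ) (D : SpinorConnection 𝕜 E F S)
  (nabla : CovariantDerivative 𝓘(ℝ, E) E (TangentSpace 𝓘(ℝ, E) : M → Type _))

/-- The derivative of the Clifford multiplication in the connection induced by `D`, `D^C` and the
Levi-Civita connection: `(D̂_v γ)(w) s = D_v (γ(w) s) - γ(∇_v w) s - γ(w) D^C_v s`. It is tensorial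
in `w` and `s`, which are extended to sections that are constant in a trivialization. -/
def hatD (x : M) (v w : TangentSpace 𝓘(ℝ, E) x) (s : S x) : S x :=
  D.toFun (fun y ↦ γ.mul y (FiberBundle.extend E w y) (FiberBundle.extend F s y)) x v
    - γ.mul x (nabla (FiberBundle.extend E w) x v) s
    - γ.mul x w (C.conj D (FiberBundle.extend F s) x v)

/-- The torsion of the spinor connection `D`: twice the skew symmetrization of `D̂γ`. -/
def torsion (x : M) (v w : TangentSpace 𝓘(ℝ, E) x) (s : S x) : S x :=
  hatD C D nabla x v w s - hatD C D nabla x w v s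

/-- `(D, K)` is admissible: the symmetric part of `D̂γ` acts trivially on the spinors in `K`. -/
def IsAdmissible (K : Set (Π x : M, S x)) : Prop :=
  ∀ ξ ∈ K, ∀ (x : M) (v w : TangentSpace 𝓘(ℝ, E) x),
    hatD C D nabla x v w (ξ x) + hatD C D nabla x w v (ξ x) = 0

variable (γ) in
/-- The field `𝔅(R; φ, ψ) = γ^μ φ ∧ γ^ν ψ ∧ R_{μν}`, where the endomorphism `R_{μν}` of `S` acts on
spinors: at every point a map from `S` to `Λ³S`. -/
def fieldB (φ ψ : Π x : M, S x) (x : M) (s : S x) : ExteriorAlgebra 𝕜 (S x) :=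
  g.contract x fun eμ e_μ ↦ g.contract x fun eν e_ν ↦
    ExteriorAlgebra.ι 𝕜 (γ.mul x eμ (φ x)) * ExteriorAlgebra.ι 𝕜 (γ.mul x eν (ψ x))
      * ExteriorAlgebra.ι 𝕜 (curvature D x e_μ e_ν s)

/-- The field
`𝔇(𝒯; φ, ψ) = (γ^μ φ ∧ 𝒯_{μν} ψ + γ^μ ψ ∧ 𝒯_{μν} φ) ⊗ e^ν`, a section of `ΛS ⊗ TM`. -/
def fieldD (φ ψ : Π x : M, S x) (x : M) :
    ExteriorAlgebra 𝕜 (S x) ⊗[ℝ] TangentSpace 𝓘(ℝ, E) x :=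
  g.contract x fun eν e_ν ↦
    (g.contract x fun eμ e_μ ↦
      ExteriorAlgebra.ι 𝕜 (γ.mul x eμ (φ x))
          * ExteriorAlgebra.ι 𝕜 (torsion C D nabla x e_μ e_ν (ψ x))
        + ExteriorAlgebra.ι 𝕜 (γ.mul x eμ (ψ x))
          * ExteriorAlgebra.ι 𝕜 (torsion C D nabla x e_μ e_ν (φ x))) ⊗ₜ[ℝ] eν

/-- `(D, K)` is flat: `𝔅(R; φ, ψ) = 𝔇(𝒯; φ, ψ) = 0` for all `φ, ψ ∈ K`. -/
def IsFlat (K : Set (Π x : M, S x)) : Prop :=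
  ∀ φ ∈ K, ∀ ψ ∈ K, (∀ x s, fieldB γ D φ ψ x s = 0) ∧ (∀ x, fieldD C D nabla φ ψ x = 0)

end Tensors

section GradedManifold

variable (𝕜 E F S) in
/-- The (super)functions `f ∈ C^∞(M)` and `ψ ∈ ΓS`, as sections of `ΛS`. -/
def generators : Set (Π x : M, ExteriorAlgebra 𝕜 (S x)) :=
  {α | ∃ f : M → 𝕜, ContMDiff 𝓘(ℝ, E) 𝓘(ℝ, 𝕜) ∞ f ∧
      α = fun x ↦ algebraMap 𝕜 (ExteriorAlgebra 𝕜 (S x)) (f x)} ∪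
    {α | ∃ ψ : Π x : M, S x, ContMDiff 𝓘(ℝ, E) (𝓘(ℝ, E).prod 𝓘(ℝ, F)) ∞ (T% ψ) ∧
      α = fun x ↦ ExteriorAlgebra.ι 𝕜 (ψ x)}

variable (𝕜 E F S) in
/-- The algebra `ΓΛS` of smooth sections of `ΛS`, i.e. of functions on the graded manifold
`(M, ΓΛS)`: those families of elements of the exterior algebras `Λ(S x)` which, near every point,
are sums of products of smooth functions and smooth sections of `S`. -/
def SuperFunctions : Subalgebra 𝕜 (Π x : M, ExteriorAlgebra 𝕜 (S x)) where
  carrier := {α | ∀ x, ∃ α' ∈ Algebra.adjoin 𝕜 (generators 𝕜 E F S),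
    ∀ᶠ y in 𝓝 x, α y = α' y}
  mul_mem' {α β} hα hβ x := by
    obtain ⟨α', h1, h2⟩ := hα x
    obtain ⟨β', h3, h4⟩ := hβ x
    refine ⟨α' * β', mul_mem h1 h3, ?_⟩
    filter_upwards [h2, h4] with y hy hy'
    simp [hy, hy']
  add_mem' {α β} hα hβ x := by
    obtain ⟨α', h1, h2⟩ := hα x
    obtain ⟨β', h3, h4⟩ := hβ x
    refine ⟨α' + β', add_mem h1 h3, ?_⟩
    filter_upwards [h2, h4] with y hy hy'
    simp [hy, hy']
  algebraMap_mem' c x :=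
    ⟨_, Subalgebra.algebraMap_mem _ c, Filter.Eventually.of_forall fun _ ↦ rfl⟩

theorem mem_superFunctions_of_mem {α : Π x : M, ExteriorAlgebra 𝕜 (S x)}
    (h : α ∈ generators 𝕜 E F S) : α ∈ SuperFunctions 𝕜 E F S :=
  fun _ ↦ ⟨α, Algebra.subset_adjoin h, Filter.Eventually.of_forall fun _ ↦ rfl⟩

/-- A smooth function on `M` as a function on the graded manifold. -/
def ofFunction (f : M → 𝕜) (hf : ContMDiff 𝓘(ℝ, E) 𝓘(ℝ, 𝕜) ∞ f) : SuperFunctions 𝕜 E F S :=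
  ⟨fun x ↦ algebraMap 𝕜 (ExteriorAlgebra 𝕜 (S x)) (f x),
    mem_superFunctions_of_mem (Or.inl ⟨f, hf, rfl⟩)⟩

/-- A spinor field as an odd function on the graded manifold. -/
def ofSpinor (ψ : Π x : M, S x) (hψ : ContMDiff 𝓘(ℝ, E) (𝓘(ℝ, E).prod 𝓘(ℝ, F)) ∞ (T% ψ)) :
    SuperFunctions 𝕜 E F S :=
  ⟨fun x ↦ ExteriorAlgebra.ι 𝕜 (ψ x), mem_superFunctions_of_mem (Or.inr ⟨ψ, hψ, rfl⟩)⟩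

/-- The grading involution of `Λ(S x)`: the identity on even and minus the identity on odd
elements. -/
def parity (x : M) : ExteriorAlgebra 𝕜 (S x) →ₐ[𝕜] ExteriorAlgebra 𝕜 (S x) :=
  CliffordAlgebra.involute

variable (𝕜 E F S) in
/-- The odd vector fields on the graded manifold `(M, ΓΛS)`: the odd superderivations of `ΓΛS`,
i.e. the linear maps exchanging even and odd functions for which
`Q(αβ) = Q(α) β + (-1)^{|α|} α Q(β)`. -/
structure OddVectorField extends SuperFunctions 𝕜 E F S →ₗ[𝕜] SuperFunctions 𝕜 E F S where
  odd_of_even (α : SuperFunctions 𝕜 E F S) (hα : ∀ x, parity x (α.1 x) = α.1 x) (x : M) :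
    parity x ((toFun α).1 x) = -(toFun α).1 x
  even_of_odd (α : SuperFunctions 𝕜 E F S) (hα : ∀ x, parity x (α.1 x) = -α.1 x) (x : M) :
    parity x ((toFun α).1 x) = (toFun α).1 x
  leibniz (α β : SuperFunctions 𝕜 E F S) (x : M) :
    (toFun (α * β)).1 x = (toFun α).1 x * β.1 x + parity x (α.1 x) * (toFun β).1 x

variable {g : PseudoRiemannianMetric E M}

/-- `Q` is the odd vector field `ı(η) = γ^μ η ⊗ ȷ_D(e_μ)`. Here `ȷ_D(X)` is the derivation of `ΓΛS`
which acts on functions as `X` and on spinors as `D_X`, so that `ı(η)` is the odd derivation with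
`ı(η) f = df(e_μ) γ^μ η` and `ı(η) ψ = γ^μ η ∧ D_μ ψ`. -/
def IsImath (γ : CliffordMultiplication 𝕜 g F S) (D : SpinorConnection 𝕜 E F S)
    (η : Π x : M, S x) (Q : OddVectorField 𝕜 E F S) : Prop :=
  (∀ (f : M → 𝕜) (hf : ContMDiff 𝓘(ℝ, E) 𝓘(ℝ, 𝕜) ∞ f) (x : M),
    (Q.toFun (ofFunction f hf)).1 x = g.contract x fun eμ e_μ ↦
      mvfderiv 𝓘(ℝ, E) f x e_μ • ExteriorAlgebra.ι 𝕜 (γ.mul x eμ (η x))) ∧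
  (∀ (ψ : Π x : M, S x) (hψ : ContMDiff 𝓘(ℝ, E) (𝓘(ℝ, E).prod 𝓘(ℝ, F)) ∞ (T% ψ)) (x : M),
    (Q.toFun (ofSpinor ψ hψ)).1 x = g.contract x fun eμ e_μ ↦
      ExteriorAlgebra.ι 𝕜 (γ.mul x eμ (η x)) * ExteriorAlgebra.ι 𝕜 (D.toFun ψ x e_μ))

/-- An odd vector field is a differential if it squares to zero. -/
def OddVectorField.IsDifferential (Q : OddVectorField 𝕜 E F S) : Prop :=
  ∀ α, Q.toFun (Q.toFun α) = 0

end GradedManifold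

end Spinors

end SpinSuper

end

open SpinSuper

/-! The operator is built directly on sections of `ΛS` as `γ^μ η ∧ D_μ`. Here `D_v` is the even
derivation `superDeriv`: in a trivialization it is the coordinate derivative plus the derivation of
the exterior algebra induced by the connection form. The Leibniz rule for `D_v` (`superDeriv_mul`)
and the sign picked up when `γ^μ η` moves past a section make the result an odd superderivation.
Smooth local dual frames show that it preserves smoothness (`imathFun_mem`). Uniqueness holds
because every odd vector field is local (`OddVectorField.apply_eq_zero`), hence determined by its
values on functions and spinors.

The square of an odd superderivation is an even derivation (`imathFun_imathFun_mul`), so it vanishes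
as soon as it vanishes on functions and spinors. It is computed in `imathFun_imathFun_eq`. Since
`D^C η = 0`, the derivative of `γ^μ η` in the direction `e_ν` is `(D̂_ν γ)(e^μ) η + (∇_ν e^μ) η`.
The first summand yields the first order operator with coefficient `torsionForm`. The second
completes `D_ν D_μ` to a covariant Hessian; the products `γ^ν η ∧ γ^μ η` antisymmetrize it, and as
`∇` is torsion free only half the curvature operator remains. On functions that operator is zero; on
spinors it gives `½ 𝔅(R; η, η)`.

Every covector at a point is the differential of a smooth function, so vanishing of the square on
functions means `torsionForm = 0`. Admissibility makes `D̂γ` skew on `η`, so that `𝔇` is four times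
`torsionForm` written as a tensor (`fieldD_eq_zero_iff`). Once this term is gone, vanishing on
spinors is exactly `𝔅(R; η, η) = 0`. -/

noncomputable section

namespace SpinSuper

/-! ### Cutoffs, differentials of functions, and the Lie bracket as a commutator -/

section Calculus

variable {E : Type*} [NormedAddCommGroup E] [NormedSpace ℝ E] [FiniteDimensional ℝ E]
  {M : Type*} [TopologicalSpace M] [ChartedSpace E M] [IsManifold 𝓘(ℝ, E) ∞ M]
  {F : Type*} [NormedAddCommGroup F] [NormedSpace ℝ F]
  {S : M → Type*} [TopologicalSpace (TotalSpace F S)]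
  [∀ x, AddCommGroup (S x)] [∀ x, Module ℝ (S x)]
  [∀ x, TopologicalSpace (S x)]
  [FiberBundle F S] [VectorBundle ℝ F S]
  [ContMDiffVectorBundle ∞ F S 𝓘(ℝ, E)]
  {W : Type*} [NormedAddCommGroup W] [NormedSpace ℝ W]

theorem two_le_infty : (2 : ℕ∞ω) ≤ ∞ :=
  WithTop.coe_le_coe.2 (le_top : (2 : ℕ∞) ≤ ⊤)

/-- A section which is smooth near `x` agrees near `x` with a globally smooth section. -/
theorem exists_contMDiff_section_eventuallyEq [T2Space M] {x : M} {σ : Π y : M, S y}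
    (h : ∀ᶠ y in 𝓝 x, ContMDiffAt 𝓘(ℝ, E) (𝓘(ℝ, E).prod 𝓘(ℝ, F)) ∞ (T% σ) y) :
    ∃ ψ : Π y : M, S y, ContMDiff 𝓘(ℝ, E) (𝓘(ℝ, E).prod 𝓘(ℝ, F)) ∞ (T% ψ) ∧
      ∀ᶠ y in 𝓝 x, ψ y = σ y := by
  obtain ⟨u, hu, hou, hxu⟩ := eventually_nhds_iff.1 h
  obtain ⟨ρ, hρ⟩ : ∃ ρ : SmoothBumpFunction 𝓘(ℝ, E) x, tsupport ρ ⊆ u := by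
    obtain ⟨ρ, -, hρ⟩ := (SmoothBumpFunction.nhds_basis_tsupport (I := 𝓘(ℝ, E)) x).mem_iff.1
      (hou.mem_nhds hxu)
    exact ⟨ρ, hρ⟩
  refine ⟨(ρ : M → ℝ) • σ, ?_, ?_⟩
  · exact ContMDiffOn.smul_section_of_tsupport ρ.contMDiff.contMDiffOn hou hρ
      fun y hy ↦ (hu y hy).contMDiffWithinAt
  · filter_upwards [ρ.eventuallyEq_one] with y hy
    simp [hy]

/-- There is a smooth function which is `1` near `x` and is supported in a given neighbourhood. -/
theorem exists_smooth_cutoff [T2Space M] {x : M} {u : Set M} (hu : u ∈ 𝓝 x) :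
    ∃ ρ : M → ℝ, ContMDiff 𝓘(ℝ, E) 𝓘(ℝ, ℝ) ∞ ρ ∧ ρ =ᶠ[𝓝 x] 1 ∧ ∀ y ∉ u, ρ y = 0 := by
  obtain ⟨ρ, -, hρ⟩ := (SmoothBumpFunction.nhds_basis_tsupport (I := 𝓘(ℝ, E)) x).mem_iff.1 hu
  exact ⟨ρ, ρ.contMDiff, ρ.eventuallyEq_one, fun y hy ↦ image_eq_zero_of_notMem_tsupport
    fun h ↦ hy (hρ h)⟩

/-- Every covector is the differential of a smooth function. -/
theorem exists_contMDiff_mvfderiv_eq [T2Space M] (x : M)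
    (ℓ : TangentSpace 𝓘(ℝ, E) x →L[ℝ] ℝ) :
    ∃ f : M → ℝ, ContMDiff 𝓘(ℝ, E) 𝓘(ℝ, ℝ) ∞ f ∧ mvfderiv 𝓘(ℝ, E) f x = ℓ := by
  have hx : x ∈ (chartAt E x).source := mem_chart_source E x
  have hinv : (mfderiv 𝓘(ℝ, E) 𝓘(ℝ, E) (extChartAt 𝓘(ℝ, E) x) x).IsInvertible :=
    isInvertible_mfderiv_extChartAt (mem_extChartAt_source x)
  obtain ⟨L, hL⟩ := hinv
  -- The covector is moved to the model space by the inverse of the chart's derivative at `x`. The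
  -- function sought is then `ℓ'` of the chart, cut off by a bump function.
  let ℓ' : E →L[ℝ] ℝ := ℓ.comp L.symm.toContinuousLinearMap
  obtain ⟨ρ⟩ : Nonempty (SmoothBumpFunction 𝓘(ℝ, E) x) := inferInstance
  have hsm : ContMDiffOn 𝓘(ℝ, E) 𝓘(ℝ, ℝ) ∞ (fun y ↦ ℓ' (extChartAt 𝓘(ℝ, E) x y))
      (chartAt E x).source :=
    ℓ'.contMDiff.comp_contMDiffOn contMDiffOn_extChartAt
  have hat : MDifferentiableAt 𝓘(ℝ, E) 𝓘(ℝ, E) (extChartAt 𝓘(ℝ, E) x) x :=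
    mdifferentiableAt_extChartAt hx
  refine ⟨fun y ↦ ρ y • ℓ' (extChartAt 𝓘(ℝ, E) x y), ρ.contMDiff_smul hsm, ?_⟩
  have h1 : (fun y ↦ ρ y • ℓ' (extChartAt 𝓘(ℝ, E) x y))
      =ᶠ[𝓝 x] ℓ' ∘ extChartAt 𝓘(ℝ, E) x := by
    filter_upwards [ρ.eventuallyEq_one] with y hy
    simp [hy]
  have h2 := (ℓ'.hasMFDerivAt.comp x hat.hasMFDerivAt)
  have h3 := (h2.congr_of_eventuallyEq h1).mfderiv
  ext v
  have h4 : mvfderiv 𝓘(ℝ, E) (fun y ↦ ρ y • ℓ' (extChartAt 𝓘(ℝ, E) x y)) x v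
      = ℓ' (mfderiv 𝓘(ℝ, E) 𝓘(ℝ, E) (extChartAt 𝓘(ℝ, E) x) x v) :=
    congrArg (fun L ↦ L v) h3
  rw [h4, ← hL]
  exact congrArg ℓ (L.symm_apply_apply v)

theorem mvfderiv_congr {f f' : M → W} {x : M} (h : f =ᶠ[𝓝 x] f') :
    mvfderiv 𝓘(ℝ, E) f x = mvfderiv 𝓘(ℝ, E) f' x := by
  ext v
  have h1 := h.mfderiv_eq (I := 𝓘(ℝ, E)) (I' := 𝓘(ℝ, W))
  exact DFunLike.congr_fun h1 v

theorem mvfderiv_clm_comp {W' : Type*} [NormedAddCommGroup W'] [NormedSpace ℝ W']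
    (L : W →L[ℝ] W') {f : M → W} {x : M} (hf : MDifferentiableAt 𝓘(ℝ, E) 𝓘(ℝ, W) f x)
    (v : TangentSpace 𝓘(ℝ, E) x) :
    mvfderiv 𝓘(ℝ, E) (fun y ↦ L (f y)) x v = L (mvfderiv 𝓘(ℝ, E) f x v) := by
  have h1 : HasMFDerivAt 𝓘(ℝ, W) 𝓘(ℝ, W') L (f x) L := L.hasMFDerivAt
  exact DFunLike.congr_fun (h1.comp x hf.hasMFDerivAt).mfderiv v

/-- Composing the tangent map of `f` with the section `V` gives a smooth map to the tangent bundle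
of `W`, whose fibre component is this function. -/
theorem contMDiff_mvfderiv_apply {f : M → W} (hf : ContMDiff 𝓘(ℝ, E) 𝓘(ℝ, W) ∞ f)
    {V : Π y : M, TangentSpace 𝓘(ℝ, E) y}
    (hV : ContMDiff 𝓘(ℝ, E) (𝓘(ℝ, E).prod 𝓘(ℝ, E)) ∞ (T% V)) :
    ContMDiff 𝓘(ℝ, E) 𝓘(ℝ, W) ∞ (fun y ↦ mvfderiv 𝓘(ℝ, E) f y (V y)) := by
  have h1 := (hf.contMDiff_tangentMap (m := ∞) le_rfl).comp hV
  exact (contMDiff_snd_tangentBundle_modelSpace W 𝓘(ℝ, W)).comp h1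

/-- The differential of a function, evaluated on a vector field, read in a chart. -/
theorem fderiv_comp_extChartAt_symm {f : M → W} {x : M} {z : E}
    (hz : z ∈ (extChartAt 𝓘(ℝ, E) x).target)
    (hf : MDifferentiableAt 𝓘(ℝ, E) 𝓘(ℝ, W) f ((extChartAt 𝓘(ℝ, E) x).symm z))
    (V : Π y : M, TangentSpace 𝓘(ℝ, E) y) :
    fderiv ℝ (f ∘ (extChartAt 𝓘(ℝ, E) x).symm) z
        (VectorField.mpullback 𝓘(ℝ, E) 𝓘(ℝ, E) (extChartAt 𝓘(ℝ, E) x).symm V z)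
      = mvfderiv 𝓘(ℝ, E) f ((extChartAt 𝓘(ℝ, E) x).symm z)
          (V ((extChartAt 𝓘(ℝ, E) x).symm z)) := by
  have hinv : (mfderiv 𝓘(ℝ, E) 𝓘(ℝ, E) (extChartAt 𝓘(ℝ, E) x).symm z).IsInvertible := by
    have := isInvertible_mfderivWithin_extChartAt_symm (I := 𝓘(ℝ, E)) hz
    simpa using this
  have hS : MDifferentiableAt 𝓘(ℝ, E) 𝓘(ℝ, E) (extChartAt 𝓘(ℝ, E) x).symm z :=
    ((contMDiffOn_extChartAt_symm (n := 1) x).contMDiffAt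
      ((isOpen_extChartAt_target x).mem_nhds hz)).mdifferentiableAt (by simp)
  have h1 := (HasMFDerivAt.comp z hf.hasMFDerivAt hS.hasMFDerivAt).mfderiv
  rw [mfderiv_eq_fderiv] at h1
  obtain ⟨L, hL⟩ := hinv
  have h2 : VectorField.mpullback 𝓘(ℝ, E) 𝓘(ℝ, E) (extChartAt 𝓘(ℝ, E) x).symm V z
      = L.symm (V ((extChartAt 𝓘(ℝ, E) x).symm z)) := by
    rw [VectorField.mpullback_apply, ← hL, ContinuousLinearMap.inverse_equiv]
    rfl
  have h3 : fderiv ℝ (f ∘ (extChartAt 𝓘(ℝ, E) x).symm) z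
        (VectorField.mpullback 𝓘(ℝ, E) 𝓘(ℝ, E) (extChartAt 𝓘(ℝ, E) x).symm V z)
      = mfderiv 𝓘(ℝ, E) 𝓘(ℝ, W) f ((extChartAt 𝓘(ℝ, E) x).symm z)
        (mfderiv 𝓘(ℝ, E) 𝓘(ℝ, E) (extChartAt 𝓘(ℝ, E) x).symm z
          (VectorField.mpullback 𝓘(ℝ, E) 𝓘(ℝ, E) (extChartAt 𝓘(ℝ, E) x).symm V z)) :=
    DFunLike.congr_fun h1 _
  rw [h3, h2, ← hL]
  exact congrArg (fun v ↦ mfderiv 𝓘(ℝ, E) 𝓘(ℝ, W) f ((extChartAt 𝓘(ℝ, E) x).symm z) v)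
    (L.apply_symm_apply _)

/-- The Lie bracket of vector fields acts on functions as the commutator. -/
theorem mvfderiv_mlieBracket {f : M → W} (hf : ContMDiff 𝓘(ℝ, E) 𝓘(ℝ, W) ∞ f)
    {V V' : Π y : M, TangentSpace 𝓘(ℝ, E) y}
    (hV : ContMDiff 𝓘(ℝ, E) (𝓘(ℝ, E).prod 𝓘(ℝ, E)) ∞ (T% V))
    (hV' : ContMDiff 𝓘(ℝ, E) (𝓘(ℝ, E).prod 𝓘(ℝ, E)) ∞ (T% V')) (x : M) :
    mvfderiv 𝓘(ℝ, E) f x (VectorField.mlieBracket 𝓘(ℝ, E) V V' x)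
      = mvfderiv 𝓘(ℝ, E) (fun y ↦ mvfderiv 𝓘(ℝ, E) f y (V' y)) x (V x)
        - mvfderiv 𝓘(ℝ, E) (fun y ↦ mvfderiv 𝓘(ℝ, E) f y (V y)) x (V' x) := by
  have hxt : extChartAt 𝓘(ℝ, E) x x ∈ (extChartAt 𝓘(ℝ, E) x).target := mem_extChartAt_target x
  have hsx : (extChartAt 𝓘(ℝ, E) x).symm (extChartAt 𝓘(ℝ, E) x x) = x := extChartAt_to_inv x
  -- Everything is transported to the chart at `x`, where the claim becomes the commutator formula
  -- for flat vector fields.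
  let P : (Π y : M, TangentSpace 𝓘(ℝ, E) y) → E → E := fun V ↦
    VectorField.mpullback 𝓘(ℝ, E) 𝓘(ℝ, E) (extChartAt 𝓘(ℝ, E) x).symm V
  set z := extChartAt 𝓘(ℝ, E) x x with hz
  set f' := f ∘ (extChartAt 𝓘(ℝ, E) x).symm with hf'
  have hf'2 : ContDiffAt ℝ 2 f' z := by
    have h1 : ContMDiffAt 𝓘(ℝ, E) 𝓘(ℝ, E) 2 (extChartAt 𝓘(ℝ, E) x).symm z :=
      ((contMDiffOn_extChartAt_symm (n := ∞) x).contMDiffAt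
        ((isOpen_extChartAt_target x).mem_nhds hxt)).of_le two_le_infty
    exact ((hf.of_le two_le_infty).contMDiffAt.comp z h1).contDiffAt
  have hPd {V : Π y : M, TangentSpace 𝓘(ℝ, E) y}
      (hV : ContMDiff 𝓘(ℝ, E) (𝓘(ℝ, E).prod 𝓘(ℝ, E)) ∞ (T% V)) :
      DifferentiableAt ℝ (P V) z := by
    have h1 := MDifferentiableWithinAt.differentiableWithinAt_mpullbackWithin_vectorField
      (s := Set.univ) (hV.mdifferentiable (by simp) x).mdifferentiableWithinAt
    simp only [modelWithCornersSelf_coe, Set.range_id, VectorField.mpullbackWithin_univ,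
      Set.preimage_univ, Set.inter_univ] at h1
    exact differentiableWithinAt_univ.1 h1
  -- Product rule in the chart: a Hessian term, symmetric in the two fields, plus the derivative of
  -- `f'` along the derivative of the inner field. Only the latter survives in the commutator.
  have key {V V' : Π y : M, TangentSpace 𝓘(ℝ, E) y}
      (hV' : ContMDiff 𝓘(ℝ, E) (𝓘(ℝ, E).prod 𝓘(ℝ, E)) ∞ (T% V')) :
      mvfderiv 𝓘(ℝ, E) (fun y ↦ mvfderiv 𝓘(ℝ, E) f y (V' y)) x (V x)
        = fderiv ℝ (fderiv ℝ f') z (P V z) (P V' z) + fderiv ℝ f' z (fderiv ℝ (P V') z (P V z)) := by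
    have h1 := (contMDiff_mvfderiv_apply hf hV').mdifferentiable (by simp)
    have h2 := fderiv_comp_extChartAt_symm hxt (h1 _) V
    rw [hsx] at h2
    rw [← h2]
    have h3 : (fun y ↦ mvfderiv 𝓘(ℝ, E) f y (V' y)) ∘ (extChartAt 𝓘(ℝ, E) x).symm
        =ᶠ[𝓝 z] fun w ↦ fderiv ℝ f' w (P V' w) := by
      filter_upwards [(isOpen_extChartAt_target x).mem_nhds hxt] with w hw
      exact (fderiv_comp_extChartAt_symm hw (hf.mdifferentiable (by simp) _) V').symm
    have h4 : DifferentiableAt ℝ (fderiv ℝ f') z :=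
      (hf'2.fderiv_right (m := 1) (by norm_num)).differentiableAt (by simp)
    have h5 := (h4.hasFDerivAt.clm_apply (hPd hV').hasFDerivAt).fderiv
    rw [h3.fderiv_eq, h5, add_comm]
    rfl
  have hbr : mvfderiv 𝓘(ℝ, E) f x (VectorField.mlieBracket 𝓘(ℝ, E) V V' x)
      = fderiv ℝ f' z (fderiv ℝ (P V') z (P V z) - fderiv ℝ (P V) z (P V' z)) := by
    obtain ⟨L, hL⟩ := isInvertible_mfderiv_extChartAt (I := 𝓘(ℝ, E)) (mem_extChartAt_source x)
    have h1 : VectorField.mlieBracket 𝓘(ℝ, E) V V' x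
        = L.symm (VectorField.lieBracket ℝ (P V) (P V') z : E) := by
      rw [← VectorField.mlieBracketWithin_univ, VectorField.mlieBracketWithin_apply, ← hL,
        ContinuousLinearMap.inverse_equiv]
      simp only [modelWithCornersSelf_coe, Set.range_id, VectorField.mpullbackWithin_univ,
        Set.preimage_univ, Set.inter_univ]
      exact congrArg (fun u : E ↦ L.symm u)
        (congrFun (VectorField.lieBracketWithin_univ (𝕜 := ℝ) (V := P V) (W := P V')) z)
    have h2 : f =ᶠ[𝓝 x] f' ∘ extChartAt 𝓘(ℝ, E) x := by
      filter_upwards [extChartAt_source_mem_nhds (I := 𝓘(ℝ, E)) x] with y hy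
      simp only [hf', Function.comp_apply]
      rw [(extChartAt 𝓘(ℝ, E) x).left_inv hy]
    have h3 : HasMFDerivAt 𝓘(ℝ, E) 𝓘(ℝ, W) f' z (fderiv ℝ f' z) :=
      (hf'2.differentiableAt (by simp)).hasFDerivAt.hasMFDerivAt
    have h6 : MDifferentiableAt 𝓘(ℝ, E) 𝓘(ℝ, E) (extChartAt 𝓘(ℝ, E) x) x :=
      mdifferentiableAt_extChartAt (mem_chart_source E x)
    have h4 := ((h3.comp x h6.hasMFDerivAt).congr_of_eventuallyEq h2).mfderiv
    have h5 (u : TangentSpace 𝓘(ℝ, E) x) : mvfderiv 𝓘(ℝ, E) f x u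
        = fderiv ℝ f' z (mfderiv 𝓘(ℝ, E) 𝓘(ℝ, E) (extChartAt 𝓘(ℝ, E) x) x u) :=
      DFunLike.congr_fun h4 u
    rw [h5, h1, ← hL]
    exact congrArg (fderiv ℝ f' z) (L.apply_symm_apply _)
  have hsymm : IsSymmSndFDerivAt ℝ f' z := hf'2.isSymmSndFDerivAt (by simp)
  rw [hbr, key hV', key hV, map_sub, hsymm.eq (P V z) (P V' z)]
  abel

end Calculus

/-! ### Dual frames: expansions, frame independence of contractions, smooth local choices -/

section Frames

variable {E : Type*} [NormedAddCommGroup E] [NormedSpace ℝ E] [FiniteDimensional ℝ E]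
  {M : Type*} [TopologicalSpace M] [ChartedSpace E M] [IsManifold 𝓘(ℝ, E) ∞ M]
  (g : PseudoRiemannianMetric E M)

theorem contMDiff_matrix_det {n : Type*} [Fintype n] [DecidableEq n] {A : M → Matrix n n ℝ}
    (hA : ∀ i j, ContMDiff 𝓘(ℝ, E) 𝓘(ℝ, ℝ) ∞ fun y ↦ A y i j) :
    ContMDiff 𝓘(ℝ, E) 𝓘(ℝ, ℝ) ∞ fun y ↦ (A y).det := by
  simp only [Matrix.det_apply]
  refine contMDiff_finsetSum fun σ _ ↦ ?_
  have h1 : ContMDiff 𝓘(ℝ, E) 𝓘(ℝ, ℝ) ∞ fun y ↦ ∏ i, A y (σ i) i :=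
    contMDiff_finsetProd fun i _ ↦ hA _ _
  rcases Int.units_eq_one_or (Equiv.Perm.sign σ) with h | h
  · simpa [h] using h1
  · simpa [h] using h1.neg

namespace PseudoRiemannianMetric

theorem contMDiff_val {X Y : Π y : M, TangentSpace 𝓘(ℝ, E) y}
    (hX : ContMDiff 𝓘(ℝ, E) (𝓘(ℝ, E).prod 𝓘(ℝ, E)) ∞ (T% X))
    (hY : ContMDiff 𝓘(ℝ, E) (𝓘(ℝ, E).prod 𝓘(ℝ, E)) ∞ (T% Y)) :
    ContMDiff 𝓘(ℝ, E) 𝓘(ℝ, ℝ) ∞ fun y ↦ g.val y (X y) (Y y) := by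
  intro x
  have : ContMDiffAt 𝓘(ℝ, E) (𝓘(ℝ, E).prod 𝓘(ℝ, ℝ)) ∞
      (fun m ↦ TotalSpace.mk' ℝ (E := Bundle.Trivial M ℝ) m (g.val m (X m) (Y m))) x := by
    apply ContMDiffAt.clm_bundle_apply₂ (F₁ := E) (F₂ := E)
    · exact g.contMDiff.contMDiffAt
    · exact hX x
    · exact hY x
  simp only [contMDiffAt_totalSpace] at this
  exact this.2

theorem val_coframe_frame (x : M) (μ ν : Fin (Module.finrank ℝ E)) :
    g.val x (g.coframe x μ) (frame x ν) = if μ = ν then 1 else 0 := by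
  have := (g.bilin x).apply_dualBasis_left (g.bilin_nondegenerate x) (frame x) μ ν
  rw [show (if μ = ν then (1 : ℝ) else 0) = if ν = μ then 1 else 0 by simp [eq_comm], ← this]
  rfl

section Dual

variable {g} {x : M} {e e' : Fin (Module.finrank ℝ E) → TangentSpace 𝓘(ℝ, E) x}

/-- Pairing a linear relation with `e' μ` isolates its `μ`-th coefficient, so duality alone forces
linear independence. The number of vectors is the dimension, so they form a basis whose coordinates
are the pairings. -/
theorem sum_val_smul_of_dual
    (h : ∀ μ ν, g.val x (e' μ) (e ν) = if μ = ν then 1 else 0)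
    (v : TangentSpace 𝓘(ℝ, E) x) :
    ∑ μ, g.val x (e' μ) v • e μ = v := by
  have : FiniteDimensional ℝ (TangentSpace 𝓘(ℝ, E) x) := inferInstanceAs (FiniteDimensional ℝ E)
  have hli : LinearIndependent ℝ e := by
    rw [Fintype.linearIndependent_iff]
    intro c hc μ
    simpa [h] using congrArg (g.val x (e' μ)) hc
  have hcard : Fintype.card (Fin (Module.finrank ℝ E))
      = Module.finrank ℝ (TangentSpace 𝓘(ℝ, E) x) := Fintype.card_fin _
  let b := basisOfLinearIndependentOfCardEqFinrank' _ hli hcard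
  have hb (μ) : b μ = e μ := by simp [b]
  have key : ∑ μ, g.val x (e' μ) v • e μ = ∑ μ, b.repr v μ • b μ := by
    refine Finset.sum_congr rfl fun μ _ ↦ ?_
    have h1 : g.val x (e' μ) v = b.repr v μ := by
      conv_lhs => rw [← b.sum_repr v]
      simp [hb, h]
    rw [h1, hb]
  rw [key, b.sum_repr]

theorem sum_val_smul_of_dual'
    (h : ∀ μ ν, g.val x (e' μ) (e ν) = if μ = ν then 1 else 0)
    (v : TangentSpace 𝓘(ℝ, E) x) :
    ∑ μ, g.val x v (e μ) • e' μ = v := by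
  have h1 := sum_val_smul_of_dual (g := g) (e := e') (e' := e)
    (fun μ ν ↦ by rw [g.symm, h]; simp [eq_comm]) v
  simpa only [g.symm x v] using h1

/-- The matrix `g(e'_μ, frame_ν)` expresses `frame` through `e` and, transposed, `e'` through
`coframe`; bilinearity lets it move from one slot to the other. -/
theorem contract_eq_sum_of_dual
    (h : ∀ μ ν, g.val x (e' μ) (e ν) = if μ = ν then 1 else 0)
    {W : Type*} [AddCommGroup W] [Module ℝ W]
    (B : TangentSpace 𝓘(ℝ, E) x →ₗ[ℝ] TangentSpace 𝓘(ℝ, E) x →ₗ[ℝ] W) :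
    g.contract x (fun v w ↦ B v w) = ∑ μ, B (e' μ) (e μ) := by
  have h1 (μ) : e' μ = ∑ ν, g.val x (e' μ) (frame x ν) • g.coframe x ν :=
    (sum_val_smul_of_dual' (g.val_coframe_frame x) _).symm
  have h2 (ν) : frame x ν = ∑ μ, g.val x (e' μ) (frame x ν) • e μ :=
    (sum_val_smul_of_dual h _).symm
  calc g.contract x (fun v w ↦ B v w)
      = ∑ ν, B (g.coframe x ν) (∑ μ, g.val x (e' μ) (frame x ν) • e μ) :=
        Finset.sum_congr rfl fun ν _ ↦ by rw [← h2]
    _ = ∑ μ, B (∑ ν, g.val x (e' μ) (frame x ν) • g.coframe x ν) (e μ) := by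
        simp only [map_sum, map_smul, LinearMap.sum_apply, LinearMap.smul_apply]
        exact Finset.sum_comm
    _ = _ := Finset.sum_congr rfl fun μ _ ↦ by rw [← h1]

end Dual

/-- Near every point, the coordinate frame and its `g`-dual frame are restrictions of globally
smooth vector fields. -/
theorem exists_dual_frame [T2Space M] (x : M) :
    ∃ e e' : Fin (Module.finrank ℝ E) → Π y : M, TangentSpace 𝓘(ℝ, E) y,
      (∀ μ, ContMDiff 𝓘(ℝ, E) (𝓘(ℝ, E).prod 𝓘(ℝ, E)) ∞ (T% (e μ))) ∧
      (∀ μ, ContMDiff 𝓘(ℝ, E) (𝓘(ℝ, E).prod 𝓘(ℝ, E)) ∞ (T% (e' μ))) ∧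
      (∀ μ, ∀ᶠ y in 𝓝 x, e μ y = FiberBundle.extend E (frame x μ) y) ∧
      (∀ᶠ y in 𝓝 x, ∀ μ ν, g.val y (e' μ y) (e ν y) = if μ = ν then 1 else 0) := by
  have h1 (μ : Fin (Module.finrank ℝ E)) := exists_contMDiff_section_eventuallyEq (x := x)
    (E := E) (M := M) (F := E) (σ := FiberBundle.extend E (frame (E := E) x μ)) (by
      obtain ⟨s, hs, hsσ⟩ := FiberBundle.exists_contMDiffOn_extend (k := ∞) 𝓘(ℝ, E) E
        (frame (E := E) x μ)
      filter_upwards [eventually_mem_nhds_iff.2 hs] with y hy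
      exact hsσ.contMDiffAt hy)
  choose e he hex using h1
  -- The dual frame is obtained from the inverse Gram matrix. The determinant is nonzero at `x` by
  -- nondegeneracy of the metric, hence near `x` by continuity.
  let G : M → Matrix (Fin (Module.finrank ℝ E)) (Fin (Module.finrank ℝ E)) ℝ :=
    fun y ↦ Matrix.of fun μ ν ↦ g.val y (e μ y) (e ν y)
  have hG (μ ν) : ContMDiff 𝓘(ℝ, E) 𝓘(ℝ, ℝ) ∞ fun y ↦ G y μ ν := g.contMDiff_val (he μ) (he ν)
  have hdet := contMDiff_matrix_det hG
  have hdetx : (G x).det ≠ 0 := by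
    have h2 : G x = LinearMap.BilinForm.toMatrix (frame x) (g.bilin x) := by
      ext μ ν
      have h3 (μ) : e μ x = frame x μ := by
        rw [(hex μ).self_of_nhds, FiberBundle.extend_apply_self]
      simp only [G, Matrix.of_apply, h3, LinearMap.BilinForm.toMatrix_apply]
      rfl
    rw [h2, ← LinearMap.BilinForm.nondegenerate_iff_det_ne_zero]
    exact g.bilin_nondegenerate x
  have hev : ∀ᶠ y in 𝓝 x, (G y).det ≠ 0 := hdet.continuous.continuousAt.eventually_ne hdetx
  have hinv (μ ν) (y : M) (hy : (G y).det ≠ 0) :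
      ContMDiffAt 𝓘(ℝ, E) 𝓘(ℝ, ℝ) ∞ (fun y ↦ (G y)⁻¹ μ ν) y := by
    -- Cramer's rule: the entries of the inverse are cofactors divided by the determinant, hence
    -- smooth wherever the latter is nonzero.
    have h2 : (fun y ↦ (G y)⁻¹ μ ν) = fun y ↦ (G y).det⁻¹ * (G y).adjugate μ ν := by
      ext y
      simp [Matrix.inv_def]
    rw [h2]
    refine (ContMDiffAt.inv₀ hdet.contMDiffAt hy).mul (ContMDiff.contMDiffAt ?_)
    simp only [Matrix.adjugate_apply]
    refine contMDiff_matrix_det fun i j ↦ ?_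
    by_cases hi : i = ν
    · subst hi
      simpa using contMDiff_const
    · simpa [Matrix.updateRow_ne hi] using hG i j
  have h4 (μ : Fin (Module.finrank ℝ E)) := exists_contMDiff_section_eventuallyEq (x := x)
    (E := E) (M := M) (F := E) (σ := fun y ↦ ∑ ν, (G y)⁻¹ μ ν • e ν y) (by
      filter_upwards [hev] with y hy
      exact ContMDiffAt.sum_section fun ν _ ↦ (hinv μ ν y hy).smul_section (he ν y))
  choose e' he' hex' using h4
  refine ⟨e, e', he, he', hex, ?_⟩
  filter_upwards [hev, Filter.eventually_all.2 hex'] with y hy hy' μ ν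
  have h5 : ((G y)⁻¹ * G y) μ ν = if μ = ν then 1 else 0 := by
    rw [Matrix.nonsing_inv_mul _ (Ne.isUnit hy), Matrix.one_apply]
  rw [← h5, hy', Matrix.mul_apply]
  simp [G]

end PseudoRiemannianMetric

end Frames

/-! ### Locality and tensoriality of the curvature of a spinor connection -/

section Connections

variable {𝕜 : Type*} [RCLike 𝕜]
  {E : Type*} [NormedAddCommGroup E] [NormedSpace ℝ E] [FiniteDimensional ℝ E]
  {M : Type*} [TopologicalSpace M] [ChartedSpace E M] [IsManifold 𝓘(ℝ, E) ∞ M]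
  {F : Type*} [NormedAddCommGroup F] [NormedSpace ℝ F] [NormedSpace 𝕜 F] [IsScalarTower ℝ 𝕜 F]
  [FiniteDimensional ℝ F]
  {S : M → Type*} [TopologicalSpace (TotalSpace F S)]
  [∀ x, AddCommGroup (S x)] [∀ x, Module ℝ (S x)] [∀ x, Module 𝕜 (S x)]
  [∀ x, IsScalarTower ℝ 𝕜 (S x)]
  [∀ x, TopologicalSpace (S x)] [∀ x, IsTopologicalAddGroup (S x)] [∀ x, ContinuousSMul ℝ (S x)]
  [FiberBundle F S] [VectorBundle ℝ F S] [VectorBundle 𝕜 F S]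
  [ContMDiffVectorBundle ∞ F S 𝓘(ℝ, E)]

theorem contMDiff_extend_eventually {F' : Type*} [NormedAddCommGroup F'] [NormedSpace ℝ F']
    {S' : M → Type*} [TopologicalSpace (TotalSpace F' S')]
    [∀ x, AddCommGroup (S' x)] [∀ x, Module ℝ (S' x)] [∀ x, TopologicalSpace (S' x)]
    [FiberBundle F' S'] [VectorBundle ℝ F' S'] [ContMDiffVectorBundle ∞ F' S' 𝓘(ℝ, E)]
    {x : M} (s : S' x) :
    ∀ᶠ y in 𝓝 x, ContMDiffAt 𝓘(ℝ, E) (𝓘(ℝ, E).prod 𝓘(ℝ, F')) ∞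
      (T% (FiberBundle.extend F' s)) y := by
  obtain ⟨u, hu, hσ⟩ := FiberBundle.exists_contMDiffOn_extend (k := ∞) 𝓘(ℝ, E) F' s
  filter_upwards [eventually_mem_nhds_iff.2 hu] with y hy
  exact hσ.contMDiffAt hy

theorem exists_contMDiff_section_apply_eq [T2Space M] {x : M} (s : S x) :
    ∃ ψ : Π y : M, S y, ContMDiff 𝓘(ℝ, E) (𝓘(ℝ, E).prod 𝓘(ℝ, F)) ∞ (T% ψ) ∧
      (∀ᶠ y in 𝓝 x, ψ y = FiberBundle.extend F s y) ∧ ψ x = s := by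
  obtain ⟨ψ, hψ, h⟩ := exists_contMDiff_section_eventuallyEq
    (contMDiff_extend_eventually (E := E) (F' := F) s)
  exact ⟨ψ, hψ, h, by rw [h.self_of_nhds, FiberBundle.extend_apply_self]⟩

theorem mdifferentiableAt_section_congr {x : M} {ψ ψ' : Π y : M, S y}
    (hψ : MDiffAt (T% ψ) x) (h : ∀ᶠ y in 𝓝 x, ψ' y = ψ y) : MDiffAt (T% ψ') x := by
  refine MDifferentiableAt.congr_of_eventuallyEq hψ ?_
  filter_upwards [h] with y hy
  rw [hy]

namespace SpinorConnection

variable (D : SpinorConnection 𝕜 E F S)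

theorem toFun_congr {x : M} {ψ ψ' : Π y : M, S y} (hψ : MDiffAt (T% ψ) x)
    (h : ∀ᶠ y in 𝓝 x, ψ' y = ψ y) : D.toFun ψ' x = D.toFun ψ x :=
  D.isCovariantDerivativeOnUniv.congr_of_eventuallyEq (mdifferentiableAt_section_congr hψ h) hψ
    Filter.univ_mem h

theorem contMDiff_apply {ψ : Π y : M, S y}
    (hψ : ContMDiff 𝓘(ℝ, E) (𝓘(ℝ, E).prod 𝓘(ℝ, F)) ∞ (T% ψ))
    {V : Π y : M, TangentSpace 𝓘(ℝ, E) y}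
    (hV : ContMDiff 𝓘(ℝ, E) (𝓘(ℝ, E).prod 𝓘(ℝ, E)) ∞ (T% V)) :
    ContMDiff 𝓘(ℝ, E) (𝓘(ℝ, E).prod 𝓘(ℝ, F)) ∞ (T% fun y ↦ D.toFun ψ y (V y)) := by
  have h1 := D.smooth.contMDiff.contMDiff (σ := ψ) (by simpa using hψ.contMDiffOn)
  rw [contMDiffOn_univ] at h1
  exact h1.clm_bundle_apply hV

/-- The curvature operator `D_V D_W - D_W D_V - D_{[V, W]}` on sections. -/
def curvatureOp (V W : Π y : M, TangentSpace 𝓘(ℝ, E) y) (ψ : Π y : M, S y) (x : M) : S x :=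
  D.toFun (fun y ↦ D.toFun ψ y (W y)) x (V x) - D.toFun (fun y ↦ D.toFun ψ y (V y)) x (W x)
    - D.toFun ψ x (VectorField.mlieBracket 𝓘(ℝ, E) V W x)

section curvatureOp

variable {V W : Π y : M, TangentSpace 𝓘(ℝ, E) y}

/-- Two derivatives are taken, so locality of `D` is applied at all points near `x` before it is
applied at `x`. -/
theorem curvatureOp_congr
    (hV : ContMDiff 𝓘(ℝ, E) (𝓘(ℝ, E).prod 𝓘(ℝ, E)) ∞ (T% V))
    (hW : ContMDiff 𝓘(ℝ, E) (𝓘(ℝ, E).prod 𝓘(ℝ, E)) ∞ (T% W))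
    {ψ ψ' : Π y : M, S y}
    (hψ : ContMDiff 𝓘(ℝ, E) (𝓘(ℝ, E).prod 𝓘(ℝ, F)) ∞ (T% ψ)) {x : M}
    (h : ∀ᶠ y in 𝓝 x, ψ' y = ψ y) : D.curvatureOp V W ψ' x = D.curvatureOp V W ψ x := by
  have h1 (U : Π y : M, TangentSpace 𝓘(ℝ, E) y) :
      ∀ᶠ y in 𝓝 x, D.toFun ψ' y (U y) = D.toFun ψ y (U y) := by
    filter_upwards [h.eventually_nhds] with y hy
    rw [D.toFun_congr (hψ.mdifferentiable (by simp) y) hy]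
  rw [curvatureOp, curvatureOp,
    D.toFun_congr ((D.contMDiff_apply hψ hW).mdifferentiable (by simp) x) (h1 W),
    D.toFun_congr ((D.contMDiff_apply hψ hV).mdifferentiable (by simp) x) (h1 V),
    D.toFun_congr (hψ.mdifferentiable (by simp) x) h]

theorem curvatureOp_add
    (hV : ContMDiff 𝓘(ℝ, E) (𝓘(ℝ, E).prod 𝓘(ℝ, E)) ∞ (T% V))
    (hW : ContMDiff 𝓘(ℝ, E) (𝓘(ℝ, E).prod 𝓘(ℝ, E)) ∞ (T% W))
    {ψ ψ' : Π y : M, S y}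
    (hψ : ContMDiff 𝓘(ℝ, E) (𝓘(ℝ, E).prod 𝓘(ℝ, F)) ∞ (T% ψ))
    (hψ' : ContMDiff 𝓘(ℝ, E) (𝓘(ℝ, E).prod 𝓘(ℝ, F)) ∞ (T% ψ')) (x : M) :
    D.curvatureOp V W (ψ + ψ') x = D.curvatureOp V W ψ x + D.curvatureOp V W ψ' x := by
  have h0 (y : M) : D.toFun (ψ + ψ') y = D.toFun ψ y + D.toFun ψ' y :=
    D.isCovariantDerivativeOnUniv.add (hψ.mdifferentiable (by simp) y)
      (hψ'.mdifferentiable (by simp) y)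
  have h1 {U : Π y : M, TangentSpace 𝓘(ℝ, E) y}
      (hU : ContMDiff 𝓘(ℝ, E) (𝓘(ℝ, E).prod 𝓘(ℝ, E)) ∞ (T% U)) :
      D.toFun (fun y ↦ D.toFun (ψ + ψ') y (U y)) x
        = D.toFun (fun y ↦ D.toFun ψ y (U y)) x + D.toFun (fun y ↦ D.toFun ψ' y (U y)) x := by
    have h2 : (fun y ↦ D.toFun (ψ + ψ') y (U y))
        = (fun y ↦ D.toFun ψ y (U y)) + fun y ↦ D.toFun ψ' y (U y) := by
      ext y
      simp [h0]
    rw [h2]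
    exact D.isCovariantDerivativeOnUniv.add
      ((D.contMDiff_apply hψ hU).mdifferentiable (by simp) x)
      ((D.contMDiff_apply hψ' hU).mdifferentiable (by simp) x)
  unfold curvatureOp
  rw [h1 hV, h1 hW, h0]
  simp only [add_apply]
  abel

/-- The terms with one derivative of `c` and one of `ψ` cancel by symmetry in `V` and `W`. The
second derivatives of `c` cancel against its derivative along the bracket, by
`mvfderiv_mlieBracket`. -/
theorem curvatureOp_smul
    (hV : ContMDiff 𝓘(ℝ, E) (𝓘(ℝ, E).prod 𝓘(ℝ, E)) ∞ (T% V))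
    (hW : ContMDiff 𝓘(ℝ, E) (𝓘(ℝ, E).prod 𝓘(ℝ, E)) ∞ (T% W))
    {ψ : Π y : M, S y}
    (hψ : ContMDiff 𝓘(ℝ, E) (𝓘(ℝ, E).prod 𝓘(ℝ, F)) ∞ (T% ψ))
    {c : M → ℝ} (hc : ContMDiff 𝓘(ℝ, E) 𝓘(ℝ, ℝ) ∞ c) (x : M) :
    D.curvatureOp V W (c • ψ) x = c x • D.curvatureOp V W ψ x := by
  have hcov := D.isCovariantDerivativeOnUniv
  have h0 (y : M) : D.toFun (c • ψ) y
      = c y • D.toFun ψ y + (mvfderiv 𝓘(ℝ, E) c y).smulRight (ψ y) :=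
    hcov.leibniz (hψ.mdifferentiable (by simp) y) (hc.mdifferentiable (by simp) y)
  have h1 {U : Π y : M, TangentSpace 𝓘(ℝ, E) y}
      (hU : ContMDiff 𝓘(ℝ, E) (𝓘(ℝ, E).prod 𝓘(ℝ, E)) ∞ (T% U)) (v : TangentSpace 𝓘(ℝ, E) x) :
      D.toFun (fun y ↦ D.toFun (c • ψ) y (U y)) x v
        = c x • D.toFun (fun y ↦ D.toFun ψ y (U y)) x v
          + mvfderiv 𝓘(ℝ, E) c x v • D.toFun ψ x (U x)
          + (mvfderiv 𝓘(ℝ, E) c x (U x) • D.toFun ψ x v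
          + mvfderiv 𝓘(ℝ, E) (fun y ↦ mvfderiv 𝓘(ℝ, E) c y (U y)) x v • ψ x) := by
    have h2 : (fun y ↦ D.toFun (c • ψ) y (U y))
        = (c • fun y ↦ D.toFun ψ y (U y)) + (fun y ↦ mvfderiv 𝓘(ℝ, E) c y (U y)) • ψ := by
      ext y
      simp [h0]
    have h3 := D.contMDiff_apply hψ hU
    have h4 := contMDiff_mvfderiv_apply hc hU
    rw [h2, hcov.add ((hc.smul_section h3).mdifferentiable (by simp) x)
      ((h4.smul_section hψ).mdifferentiable (by simp) x),
      hcov.leibniz (h3.mdifferentiable (by simp) x) (hc.mdifferentiable (by simp) x),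
      hcov.leibniz (hψ.mdifferentiable (by simp) x) (h4.mdifferentiable (by simp) x)]
    simp
  unfold curvatureOp
  rw [h1 hV, h1 hW, h0]
  simp only [add_apply, smul_apply, ContinuousLinearMap.smulRight_apply, mvfderiv_mlieBracket hc hV hW]
  module

theorem curvatureOp_sum
    (hV : ContMDiff 𝓘(ℝ, E) (𝓘(ℝ, E).prod 𝓘(ℝ, E)) ∞ (T% V))
    (hW : ContMDiff 𝓘(ℝ, E) (𝓘(ℝ, E).prod 𝓘(ℝ, E)) ∞ (T% W))
    {ι : Type*} (s : Finset ι) {ψ : ι → Π y : M, S y} {c : ι → M → ℝ}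
    (hψ : ∀ i, ContMDiff 𝓘(ℝ, E) (𝓘(ℝ, E).prod 𝓘(ℝ, F)) ∞ (T% (ψ i)))
    (hc : ∀ i, ContMDiff 𝓘(ℝ, E) 𝓘(ℝ, ℝ) ∞ (c i)) (x : M) :
    D.curvatureOp V W (fun y ↦ ∑ i ∈ s, c i y • ψ i y) x
      = ∑ i ∈ s, c i x • D.curvatureOp V W (ψ i) x := by
  classical
  induction s using Finset.induction_on with
  | empty =>
    -- The empty sum is the zero function times the zero section, so its curvature vanishes by
    -- linearity over functions.
    have h := D.curvatureOp_smul hV hW (ψ := fun y : M ↦ (0 : S y)) (c := fun _ ↦ 0)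
      (contMDiff_zeroSection ℝ S) contMDiff_const x
    have h2 : (fun y : M ↦ ∑ i ∈ (∅ : Finset ι), c i y • ψ i y)
        = (fun _ : M ↦ (0 : ℝ)) • fun y : M ↦ (0 : S y) := by
      ext y
      simp
    rw [h2, h]
    simp
  | insert i s hi ih =>
    have h2 : (fun y : M ↦ ∑ j ∈ insert i s, c j y • ψ j y)
        = c i • ψ i + fun y ↦ ∑ j ∈ s, c j y • ψ j y := by
      ext y
      simp [Finset.sum_insert hi]
    rw [h2, D.curvatureOp_add hV hW ((hc i).smul_section (hψ i))
      (ContMDiff.sum_section (t := fun j y ↦ c j y • ψ j y) fun j _ ↦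
        (hc j).smul_section (hψ j)), ih,
      D.curvatureOp_smul hV hW (hψ i) (hc i), Finset.sum_insert hi]

/-- The value of the curvature operator depends only on the value of the section. -/
theorem curvatureOp_pointwise [T2Space M]
    (hV : ContMDiff 𝓘(ℝ, E) (𝓘(ℝ, E).prod 𝓘(ℝ, E)) ∞ (T% V))
    (hW : ContMDiff 𝓘(ℝ, E) (𝓘(ℝ, E).prod 𝓘(ℝ, E)) ∞ (T% W))
    {ψ ψ' : Π y : M, S y}
    (hψ : ContMDiff 𝓘(ℝ, E) (𝓘(ℝ, E).prod 𝓘(ℝ, F)) ∞ (T% ψ))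
    (hψ' : ContMDiff 𝓘(ℝ, E) (𝓘(ℝ, E).prod 𝓘(ℝ, F)) ∞ (T% ψ')) {x : M} (h : ψ x = ψ' x) :
    D.curvatureOp V W ψ x = D.curvatureOp V W ψ' x := by
  let t := trivializationAt F S x
  have hx : x ∈ t.baseSet := FiberBundle.mem_baseSet_trivializationAt' x
  let b := Module.finBasis ℝ F
  have hnear : ∀ᶠ y in 𝓝 x, y ∈ t.baseSet := t.open_baseSet.mem_nhds hx
  have h1 (i) := exists_contMDiff_section_eventuallyEq (x := x) (E := E) (F := F)
    (σ := t.localFrame b i) (by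
      filter_upwards [hnear] with y hy
      exact contMDiffAt_localFrame_of_mem ∞ t b i hy)
  choose s hs hst using h1
  -- Expanding `ψ` in a local frame and using linearity over functions leaves a formula in which `ψ`
  -- enters only through its coefficients at `x`.
  have key {ψ : Π y : M, S y}
      (hψ : ContMDiff 𝓘(ℝ, E) (𝓘(ℝ, E).prod 𝓘(ℝ, F)) ∞ (T% ψ)) :
      D.curvatureOp V W ψ x
        = ∑ i, t.localFrameCoeff 𝓘(ℝ, E) b i x (ψ x) • D.curvatureOp V W (s i) x := by
    -- The coefficients are smooth only over the base set of the trivialization; cutting `ψ` off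
    -- inside it makes them globally smooth without changing them near `x`.
    obtain ⟨ρ, hρ⟩ : ∃ ρ : SmoothBumpFunction 𝓘(ℝ, E) x, tsupport ρ ⊆ t.baseSet := by
      obtain ⟨ρ, -, hρ⟩ := (SmoothBumpFunction.nhds_basis_tsupport (I := 𝓘(ℝ, E)) x).mem_iff.1
        (t.open_baseSet.mem_nhds hx)
      exact ⟨ρ, hρ⟩
    have h2 (i) : ContMDiff 𝓘(ℝ, E) 𝓘(ℝ, ℝ) ∞
        (fun y ↦ t.localFrameCoeff 𝓘(ℝ, E) b i y (((ρ : M → ℝ) • ψ) y)) := by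
      intro y
      by_cases hy : y ∈ tsupport ρ
      · exact contMDiffAt_localFrameCoeff b (hρ hy)
          ((ρ.contMDiff.smul_section hψ).contMDiffAt) i
      · have h4 : (fun z ↦ t.localFrameCoeff 𝓘(ℝ, E) b i z (((ρ : M → ℝ) • ψ) z))
            =ᶠ[𝓝 y] fun _ ↦ 0 := by
          filter_upwards [(isClosed_tsupport ρ).isOpen_compl.mem_nhds hy] with z hz
          simp [image_eq_zero_of_notMem_tsupport hz]
        exact contMDiffAt_const.congr_of_eventuallyEq h4
    have h3 : ∀ᶠ y in 𝓝 x, ψ y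
        = ∑ i, t.localFrameCoeff 𝓘(ℝ, E) b i y (((ρ : M → ℝ) • ψ) y) • s i y := by
      filter_upwards [hnear, Filter.eventually_all.2 hst, ρ.eventuallyEq_one] with y hy hy' hρ
      simp only [hy']
      rw [← Trivialization.eq_sum_localFrameCoeff_smul (I := 𝓘(ℝ, E)) (b := b) hy
        (s := (ρ : M → ℝ) • ψ)]
      simp [hρ]
    rw [D.curvatureOp_congr hV hW (ContMDiff.sum_section
        (t := fun i y ↦ t.localFrameCoeff 𝓘(ℝ, E) b i y (((ρ : M → ℝ) • ψ) y) • s i y)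
        fun j _ ↦ (h2 j).smul_section (hs j)) h3,
      D.curvatureOp_sum hV hW _ hs h2]
    simp
  rw [key hψ, key hψ', h]

end curvatureOp

/-- The curvature tensor is computed by the curvature operator on smooth sections. -/
theorem curvatureOp_eq_curvature [T2Space M] {V W : Π y : M, TangentSpace 𝓘(ℝ, E) y}
    (hV : ContMDiff 𝓘(ℝ, E) (𝓘(ℝ, E).prod 𝓘(ℝ, E)) ∞ (T% V))
    (hW : ContMDiff 𝓘(ℝ, E) (𝓘(ℝ, E).prod 𝓘(ℝ, E)) ∞ (T% W))
    {x : M} {v w : TangentSpace 𝓘(ℝ, E) x}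
    (hVx : ∀ᶠ y in 𝓝 x, V y = FiberBundle.extend E v y)
    (hWx : ∀ᶠ y in 𝓝 x, W y = FiberBundle.extend E w y) {ψ : Π y : M, S y}
    (hψ : ContMDiff 𝓘(ℝ, E) (𝓘(ℝ, E).prod 𝓘(ℝ, F)) ∞ (T% ψ)) :
    D.curvatureOp V W ψ x = curvature D x v w (ψ x) := by
  -- By tensoriality `ψ` may be replaced by a smooth section that coincides near `x` with the
  -- extension appearing in `curvature`.
  obtain ⟨ψ', hψ', hψ'x, hval⟩ := exists_contMDiff_section_apply_eq (E := E) (F := F) (ψ x)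
  rw [D.curvatureOp_pointwise hV hW hψ hψ' hval.symm, curvatureOp, curvature]
  have h1 {U : Π y : M, TangentSpace 𝓘(ℝ, E) y} {u : TangentSpace 𝓘(ℝ, E) x}
      (hU : ContMDiff 𝓘(ℝ, E) (𝓘(ℝ, E).prod 𝓘(ℝ, E)) ∞ (T% U))
      (hUx : ∀ᶠ y in 𝓝 x, U y = FiberBundle.extend E u y) :
      D.toFun (fun y ↦ D.toFun (FiberBundle.extend F (ψ x)) y (FiberBundle.extend E u y)) x
        = D.toFun (fun y ↦ D.toFun ψ' y (U y)) x := by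
    refine D.toFun_congr ((D.contMDiff_apply hψ' hU).mdifferentiable (by simp) x) ?_
    filter_upwards [hUx, hψ'x.eventually_nhds] with y hy hy'
    rw [hy, D.toFun_congr (hψ'.mdifferentiable (by simp) y) (hy'.mono fun z hz ↦ hz.symm)]
  have hV0 : V x = v := by rw [hVx.self_of_nhds, FiberBundle.extend_apply_self]
  have hW0 : W x = w := by rw [hWx.self_of_nhds, FiberBundle.extend_apply_self]
  have h2 := Filter.EventuallyEq.mlieBracket_vectorField_eq (I := 𝓘(ℝ, E)) hVx hWx
  rw [h1 hV hVx, h1 hW hWx, hV0, hW0, ← h2,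
    D.toFun_congr (hψ'.mdifferentiable (by simp) x) (hψ'x.mono fun z hz ↦ hz.symm)]

end SpinorConnection

end Connections

section LocalFormulas

variable {𝕜 : Type*} [RCLike 𝕜]
  {E : Type*} [NormedAddCommGroup E] [NormedSpace ℝ E] [FiniteDimensional ℝ E]
  {M : Type*} [TopologicalSpace M] [ChartedSpace E M] [IsManifold 𝓘(ℝ, E) ∞ M]
  {F : Type*} [NormedAddCommGroup F] [NormedSpace ℝ F] [NormedSpace 𝕜 F] [IsScalarTower ℝ 𝕜 F]
  [FiniteDimensional ℝ F]
  {S : M → Type*} [TopologicalSpace (TotalSpace F S)]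
  [∀ x, AddCommGroup (S x)] [∀ x, Module ℝ (S x)] [∀ x, Module 𝕜 (S x)]
  [∀ x, IsScalarTower ℝ 𝕜 (S x)]
  [∀ x, TopologicalSpace (S x)] [∀ x, IsTopologicalAddGroup (S x)] [∀ x, ContinuousSMul ℝ (S x)]
  [FiberBundle F S] [VectorBundle ℝ F S] [VectorBundle 𝕜 F S]
  [ContMDiffVectorBundle ∞ F S 𝓘(ℝ, E)]

/-! ### Tensoriality of the derivative of the Clifford multiplication -/

section HatD

variable {g : PseudoRiemannianMetric E M} {γ : CliffordMultiplication 𝕜 g F S}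
  (C : ChargeConjugation γ) (D : SpinorConnection 𝕜 E F S)
  (nabla : CovariantDerivative 𝓘(ℝ, E) E (TangentSpace 𝓘(ℝ, E) : M → Type _))

variable (γ) in
theorem CliffordMultiplication.mdifferentiableAt_mul {W : Π y : M, TangentSpace 𝓘(ℝ, E) y}
    {ξ : Π y : M, S y} {x : M} (hW : MDiffAt (T% W) x) (hξ : MDiffAt (T% ξ) x) :
    MDiffAt (T% fun y ↦ γ.mul y (W y) (ξ y)) x := by
  apply MDifferentiableAt.clm_bundle_apply₂ (F₁ := E) (F₂ := F)
  · exact γ.contMDiff.contMDiffAt.mdifferentiableAt (by simp)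
  · exact hW
  · exact hξ

variable (γ) in
theorem CliffordMultiplication.contMDiff_mul_apply {W : Π y : M, TangentSpace 𝓘(ℝ, E) y}
    {ξ : Π y : M, S y} (hW : ContMDiff 𝓘(ℝ, E) (𝓘(ℝ, E).prod 𝓘(ℝ, E)) ∞ (T% W))
    (hξ : ContMDiff 𝓘(ℝ, E) (𝓘(ℝ, E).prod 𝓘(ℝ, F)) ∞ (T% ξ)) :
    ContMDiff 𝓘(ℝ, E) (𝓘(ℝ, E).prod 𝓘(ℝ, F)) ∞ (T% fun y ↦ γ.mul y (W y) (ξ y)) := by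
  intro x
  apply ContMDiffAt.clm_bundle_apply₂ (F₁ := E) (F₂ := F)
  · exact γ.contMDiff.contMDiffAt
  · exact hW x
  · exact hξ x

/-- The derivative of the Clifford multiplication as an operator on sections. -/
def hatDOp (x : M) (v : TangentSpace 𝓘(ℝ, E) x) (W : Π y : M, TangentSpace 𝓘(ℝ, E) y)
    (ξ : Π y : M, S y) : S x :=
  D.toFun (fun y ↦ γ.mul y (W y) (ξ y)) x v - γ.mul x (nabla W x v) (ξ x)
    - γ.mul x (W x) (C.conj D ξ x v)

/-- The term with the differential of `f` produced by `D` is cancelled by the one produced by `∇`.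
-/
theorem tensorialAt_hatDOp_left (x : M) (v : TangentSpace 𝓘(ℝ, E) x) (ξ : Π y : M, S y)
    (hξ : MDiffAt (T% ξ) x) :
    TensorialAt 𝓘(ℝ, E) E (hatDOp C D nabla x v · ξ) x where
  smul {f W} hf hW := by
    have h1 : (fun y ↦ γ.mul y ((f • W) y) (ξ y)) = f • fun y ↦ γ.mul y (W y) (ξ y) := by
      ext y; simp
    simp only [hatDOp, h1, nabla.isCovariantDerivativeOnUniv.leibniz hW hf,
      D.isCovariantDerivativeOnUniv.leibniz (γ.mdifferentiableAt_mul hW hξ) hf]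
    simp [smul_sub]
  add {W W'} hW hW' := by
    have h1 : (fun y ↦ γ.mul y ((W + W') y) (ξ y))
        = (fun y ↦ γ.mul y (W y) (ξ y)) + fun y ↦ γ.mul y (W' y) (ξ y) := by
      ext y; simp
    simp only [hatDOp, h1, nabla.isCovariantDerivativeOnUniv.add hW hW',
      D.isCovariantDerivativeOnUniv.add (γ.mdifferentiableAt_mul hW hξ)
        (γ.mdifferentiableAt_mul hW' hξ)]
    simp
    abel

/-- Here the differential of `f` cancels between `D` and `D^C`. -/
theorem tensorialAt_hatDOp_right (x : M) (v : TangentSpace 𝓘(ℝ, E) x)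
    (W : Π y : M, TangentSpace 𝓘(ℝ, E) y) (hW : MDiffAt (T% W) x) :
    TensorialAt 𝓘(ℝ, E) F (hatDOp C D nabla x v W ·) x where
  smul {f ξ} hf hξ := by
    have h1 : (fun y ↦ γ.mul y (W y) ((f • ξ) y)) = f • fun y ↦ γ.mul y (W y) (ξ y) := by
      ext y; simp
    simp only [hatDOp, h1, (C.conj D).isCovariantDerivativeOnUniv.leibniz hξ hf,
      D.isCovariantDerivativeOnUniv.leibniz (γ.mdifferentiableAt_mul hW hξ) hf]
    simp [smul_sub]
    abel
  add {ξ ξ'} hξ hξ' := by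
    have h1 : (fun y ↦ γ.mul y (W y) ((ξ + ξ') y))
        = (fun y ↦ γ.mul y (W y) (ξ y)) + fun y ↦ γ.mul y (W y) (ξ' y) := by
      ext y; simp
    simp only [hatDOp, h1, (C.conj D).isCovariantDerivativeOnUniv.add hξ hξ',
      D.isCovariantDerivativeOnUniv.add (γ.mdifferentiableAt_mul hW hξ)
        (γ.mdifferentiableAt_mul hW hξ')]
    simp
    abel

/-- `D̂γ` may be computed with arbitrary extensions of its arguments. -/
theorem hatD_apply {x : M} (v : TangentSpace 𝓘(ℝ, E) x)
    {W : Π y : M, TangentSpace 𝓘(ℝ, E) y} {ξ : Π y : M, S y}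
    (hW : MDiffAt (T% W) x) (hξ : MDiffAt (T% ξ) x) :
    hatD C D nabla x v (W x) (ξ x) = D.toFun (fun y ↦ γ.mul y (W y) (ξ y)) x v
      - γ.mul x (nabla W x v) (ξ x) - γ.mul x (W x) (C.conj D ξ x v) := by
  have h := TensorialAt.pointwise₂ (tensorialAt_hatDOp_left C D nabla x v)
    (tensorialAt_hatDOp_right C D nabla x v)
    (FiberBundle.mdifferentiableAt_extend 𝓘(ℝ, E) E (W x)) hW
    (FiberBundle.mdifferentiableAt_extend 𝓘(ℝ, E) F (ξ x)) hξ (by simp) (by simp)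
  simpa only [hatD, hatDOp, FiberBundle.extend_apply_self] using h

/-- `D̂γ`, acting on a fixed spinor, as a bilinear map. -/
def hatDBilin (x : M) (s : S x) :
    TangentSpace 𝓘(ℝ, E) x →ₗ[ℝ] TangentSpace 𝓘(ℝ, E) x →ₗ[ℝ] S x :=
  LinearMap.mk₂ ℝ (fun v w ↦ hatD C D nabla x v w s)
    (fun v v' w ↦ by simp [hatD]; abel)
    (fun c v w ↦ by simp [hatD, smul_sub])
    -- In `v` linearity is immediate from the connections; in `w`, which enters through an extension
    -- to a vector field, it comes from tensoriality.
    (fun v w w' ↦ by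
      have h := (tensorialAt_hatDOp_left C D nabla x v _
        (FiberBundle.mdifferentiableAt_extend 𝓘(ℝ, E) F s))
      have h1 := (TensorialAt.mkHom _ x h).map_add w w'
      simpa only [TensorialAt.mkHom_apply_eq_extend, hatDOp, FiberBundle.extend_apply_self]
        using! h1)
    (fun c v w ↦ by
      have h := (tensorialAt_hatDOp_left C D nabla x v _
        (FiberBundle.mdifferentiableAt_extend 𝓘(ℝ, E) F s))
      have h1 := (TensorialAt.mkHom _ x h).map_smul c w
      simpa only [TensorialAt.mkHom_apply_eq_extend, hatDOp, FiberBundle.extend_apply_self]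
        using! h1)

@[simp]
theorem hatDBilin_apply (x : M) (s : S x) (v w : TangentSpace 𝓘(ℝ, E) x) :
    hatDBilin C D nabla x s v w = hatD C D nabla x v w s := rfl

end HatD

/-! ### A connection in a trivialization -/

section Trivialization

variable (𝕜) in
/-- The section `ψ` read in the trivialization around `x`. -/
theorem mdifferentiableAt_linearMapAt {x : M} {ψ : Π y : M, S y} (hψ : MDiffAt (T% ψ) x) :
    MDifferentiableAt 𝓘(ℝ, E) 𝓘(ℝ, F)
      (fun y ↦ (trivializationAt F S x).linearMapAt 𝕜 y (ψ y)) x := by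
  rw [mdifferentiableAt_totalSpace] at hψ
  refine hψ.2.congr_of_eventuallyEq ?_
  filter_upwards [(trivializationAt F S x).open_baseSet.mem_nhds
    (FiberBundle.mem_baseSet_trivializationAt' x)] with y hy
  rw [Trivialization.coe_linearMapAt_of_mem _ hy]

variable (𝕜) in
theorem linearMapAt_extend_eventually {x : M} (s : S x) :
    ∀ᶠ y in 𝓝 x, (trivializationAt F S x).linearMapAt 𝕜 y (FiberBundle.extend F s y)
      = (trivializationAt F S x).linearMapAt 𝕜 x s := by
  filter_upwards [(trivializationAt F S x).open_baseSet.mem_nhds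
    (FiberBundle.mem_baseSet_trivializationAt' x)] with y hy
  rw [Trivialization.coe_linearMapAt_of_mem _ hy, Trivialization.coe_linearMapAt_of_mem _
    (FiberBundle.mem_baseSet_trivializationAt' x)]
  simp [FiberBundle.extend, hy]

variable (𝕜) in
/-- A connection, read in the trivialization around `x`: the derivative of the coordinates plus a
zeroth order term. -/
theorem SpinorConnection.toFun_apply_eq (D : SpinorConnection 𝕜 E F S) {x : M}
    {ψ : Π y : M, S y} (hψ : MDiffAt (T% ψ) x) (v : TangentSpace 𝓘(ℝ, E) x) :
    D.toFun ψ x v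
      = (trivializationAt F S x).symmₗ 𝕜 x (mvfderiv 𝓘(ℝ, E)
          (fun y ↦ (trivializationAt F S x).linearMapAt 𝕜 y (ψ y)) x v)
        + D.toFun (FiberBundle.extend F (ψ x)) x v := by
  let t := trivializationAt F S x
  have hx : x ∈ t.baseSet := FiberBundle.mem_baseSet_trivializationAt' x
  have hreal (c : ℝ) (s : F) : t.symmₗ 𝕜 x (c • s) = c • t.symmₗ 𝕜 x s :=
    (t.symmₗ 𝕜 x).map_smul_of_tower c s
  have hreal' (y : M) (c : ℝ) (s : S y) :
      t.linearMapAt 𝕜 y (c • s) = c • t.linearMapAt 𝕜 y s :=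
    (t.linearMapAt 𝕜 y).map_smul_of_tower c s
  have hd {σ : Π y : M, S y} (hσ : MDiffAt (T% σ) x) : MDifferentiableAt 𝓘(ℝ, E) 𝓘(ℝ, F)
      (fun y ↦ t.linearMapAt 𝕜 y (σ y)) x := mdifferentiableAt_linearMapAt 𝕜 hσ
  -- The difference between `D` and the flat connection of the trivialization is tensorial, so it
  -- can be evaluated on the extension of `ψ x`. That extension has constant coordinates, so its
  -- flat derivative is zero.
  have hT : TensorialAt 𝓘(ℝ, E) F (fun ψ : Π y : M, S y ↦ D.toFun ψ x v
      - t.symmₗ 𝕜 x (mvfderiv 𝓘(ℝ, E) (fun y ↦ t.linearMapAt 𝕜 y (ψ y)) x v)) x :=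
    { smul := fun {f σ} hf hσ ↦ by
        have h1 : (fun y ↦ t.linearMapAt 𝕜 y ((f • σ) y))
            = f • fun y ↦ t.linearMapAt 𝕜 y (σ y) := by
          ext y; simp [hreal']
        simp only [h1, mvfderiv_smul hf (hd hσ),
          D.isCovariantDerivativeOnUniv.leibniz hσ hf]
        simp [hreal, smul_sub, t.symmₗ_linearMapAt hx]
      add := fun {σ σ'} hσ hσ' ↦ by
        have h1 : (fun y ↦ t.linearMapAt 𝕜 y ((σ + σ') y))
            = (fun y ↦ t.linearMapAt 𝕜 y (σ y)) + fun y ↦ t.linearMapAt 𝕜 y (σ' y) := by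
          ext y; simp
        simp only [h1, mvfderiv_add (hd hσ)
          (hd hσ'), D.isCovariantDerivativeOnUniv.add hσ hσ']
        simp
        abel }
  have h0 := hT.pointwise hψ (FiberBundle.mdifferentiableAt_extend 𝓘(ℝ, E) F (ψ x)) (by simp)
  have h1 : mvfderiv 𝓘(ℝ, E) (fun y ↦ t.linearMapAt 𝕜 y (FiberBundle.extend F (ψ x) y)) x = 0 :=
    (mvfderiv_congr (linearMapAt_extend_eventually (F := F) 𝕜 (ψ x))).trans (mvfderiv_const _)
  rw [h1, zero_apply, map_zero, sub_zero, sub_eq_iff_eq_add'] at h0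
  exact h0

end Trivialization

end LocalFormulas

/-! ### Derivations of an exterior algebra induced by endomorphisms -/

section ExteriorDerivation

variable {R V V' : Type*} [CommRing R] [AddCommGroup V] [Module R V] [AddCommGroup V'] [Module R V']

theorem exteriorAlgebra_ι_mul_swap (v w : V) :
    ExteriorAlgebra.ι R v * ExteriorAlgebra.ι R w
      = -(ExteriorAlgebra.ι R w * ExteriorAlgebra.ι R v) :=
  eq_neg_of_add_eq_zero_left (ExteriorAlgebra.ι_add_mul_swap v w)

/-- The algebra homomorphism to the dual numbers whose dual part is the derivation of the exterior
algebra extending the endomorphism `A`. -/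
def exteriorDualLift (A : V →ₗ[R] V) :
    ExteriorAlgebra R V →ₐ[R] DualNumber (ExteriorAlgebra R V) :=
  ExteriorAlgebra.lift R
    ⟨{ toFun := fun v ↦ (TrivSqZeroExt.inl (ExteriorAlgebra.ι R v)
          + TrivSqZeroExt.inr (ExteriorAlgebra.ι R (A v)) : DualNumber (ExteriorAlgebra R V))
       map_add' := fun v w ↦ by ext <;> simp
       map_smul' := fun c v ↦ by ext <;> simp },
      -- The universal property asks that generators square to zero: the dual part of the square is
      -- the anticommutator of `ι v` and `ι (A v)`, which vanishes.
      fun v ↦ by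
        ext
        · simp
        · simp [exteriorAlgebra_ι_mul_swap v]⟩

theorem fst_exteriorDualLift (A : V →ₗ[R] V) (a : ExteriorAlgebra R V) :
    (exteriorDualLift A a).fst = a := by
  have h : (TrivSqZeroExt.fstHom R (ExteriorAlgebra R V) (ExteriorAlgebra R V)).comp
      (exteriorDualLift A) = AlgHom.id R _ := by
    ext v
    simp [exteriorDualLift]
  exact AlgHom.congr_fun h a

/-- The derivation of the exterior algebra extending the endomorphism `A`. -/
def exteriorDerivation (A : V →ₗ[R] V) : ExteriorAlgebra R V →ₗ[R] ExteriorAlgebra R V where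
  toFun a := (exteriorDualLift A a).snd
  map_add' := by simp
  map_smul' := by simp

@[simp]
theorem exteriorDerivation_ι (A : V →ₗ[R] V) (v : V) :
    exteriorDerivation A (ExteriorAlgebra.ι R v) = ExteriorAlgebra.ι R (A v) := by
  simp [exteriorDerivation, exteriorDualLift]

@[simp]
theorem exteriorDerivation_algebraMap (A : V →ₗ[R] V) (r : R) :
    exteriorDerivation A (algebraMap R _ r) = 0 := by
  simp [exteriorDerivation, TrivSqZeroExt.algebraMap_eq_inl']

/-- This is multiplicativity of `exteriorDualLift` read in the dual part, since by
`fst_exteriorDualLift` its other component is the identity. -/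
theorem exteriorDerivation_mul (A : V →ₗ[R] V) (a b : ExteriorAlgebra R V) :
    exteriorDerivation A (a * b) = exteriorDerivation A a * b + a * exteriorDerivation A b := by
  have h := congrArg TrivSqZeroExt.snd (map_mul (exteriorDualLift A) a b)
  simp only [TrivSqZeroExt.snd_mul, fst_exteriorDualLift, smul_eq_mul,
    op_smul_eq_mul] at h
  simp only [exteriorDerivation, LinearMap.coe_mk, AddHom.coe_mk]
  rw [h, add_comm]

/-- Each generator passed contributes a sign. This is the source of the sign in the super Leibniz
rule. -/
theorem ι_mul_eq_involute_mul_ι (v : V) (a : ExteriorAlgebra R V) :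
    ExteriorAlgebra.ι R v * a = CliffordAlgebra.involute a * ExteriorAlgebra.ι R v := by
  induction a using ExteriorAlgebra.induction with
  | algebraMap r => simpa using (Algebra.commutes r (ExteriorAlgebra.ι R v)).symm
  | ι w =>
    rw [exteriorAlgebra_ι_mul_swap]
    exact (neg_mul _ _).symm.trans (congrArg (· * _) (CliffordAlgebra.involute_ι w).symm)
  | mul a b ha hb => rw [← mul_assoc, ha, mul_assoc, hb, map_mul, mul_assoc]
  | add a b ha hb => rw [mul_add, ha, hb, map_add, add_mul]

theorem involute_exteriorDerivation (A : V →ₗ[R] V) (a : ExteriorAlgebra R V) :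
    CliffordAlgebra.involute (exteriorDerivation A a)
      = exteriorDerivation A (CliffordAlgebra.involute a) := by
  induction a using ExteriorAlgebra.induction with
  | algebraMap r => simp
  | ι w =>
    have h (v : V) : CliffordAlgebra.involute (ExteriorAlgebra.ι R v) = -ExteriorAlgebra.ι R v :=
      CliffordAlgebra.involute_ι v
    rw [exteriorDerivation_ι, h, h, map_neg, exteriorDerivation_ι]
  | mul a b ha hb => simp [exteriorDerivation_mul, ha, hb]
  | add a b ha hb => simp [ha, hb]

theorem involute_map (f : V →ₗ[R] V') (a : ExteriorAlgebra R V) :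
    CliffordAlgebra.involute (ExteriorAlgebra.map f a)
      = ExteriorAlgebra.map f (CliffordAlgebra.involute a) := by
  induction a using ExteriorAlgebra.induction with
  | algebraMap r => simp
  | ι w =>
    have h (v : V) : CliffordAlgebra.involute (ExteriorAlgebra.ι R v) = -ExteriorAlgebra.ι R v :=
      CliffordAlgebra.involute_ι v
    have h' (v : V') : CliffordAlgebra.involute (ExteriorAlgebra.ι R v) = -ExteriorAlgebra.ι R v :=
      CliffordAlgebra.involute_ι v
    rw [ExteriorAlgebra.map_apply_ι, h, h', map_neg, ExteriorAlgebra.map_apply_ι]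
  | mul a b ha hb => simp [ha, hb]
  | add a b ha hb => simp [ha, hb]

end ExteriorDerivation

/-! ### Differentiating maps into finite dimensional spaces by coordinates, without a norm -/

section CoordDeriv

variable {𝕜 : Type*} [RCLike 𝕜]
  {E : Type*} [NormedAddCommGroup E] [NormedSpace ℝ E] [FiniteDimensional ℝ E]
  {M : Type*} [TopologicalSpace M] [ChartedSpace E M] [IsManifold 𝓘(ℝ, E) ∞ M]
  {W : Type*} [AddCommGroup W] [Module 𝕜 W] [Module.Finite 𝕜 W]
  {W' : Type*} [AddCommGroup W'] [Module 𝕜 W'] [Module.Finite 𝕜 W']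

variable (𝕜 E) in
/-- Differentiability of a function with values in a finite dimensional `𝕜`-vector space. -/
def CoordDiffAt (h : M → W) (x : M) : Prop :=
  ∀ i, MDifferentiableAt 𝓘(ℝ, E) 𝓘(ℝ, 𝕜) (fun y ↦ (Module.finBasis 𝕜 W).repr (h y) i) x

variable (𝕜 E) in
/-- The derivative of a function with values in a finite dimensional `𝕜`-vector space. -/
def coordDeriv (h : M → W) (x : M) (v : TangentSpace 𝓘(ℝ, E) x) : W :=
  ∑ i, mvfderiv 𝓘(ℝ, E) (fun y ↦ (Module.finBasis 𝕜 W).repr (h y) i) x v • Module.finBasis 𝕜 W i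

theorem mvfderiv_sum {ι : Type*} (s : Finset ι) {c : ι → M → 𝕜} {x : M}
    (hc : ∀ i ∈ s, MDifferentiableAt 𝓘(ℝ, E) 𝓘(ℝ, 𝕜) (c i) x) (v : TangentSpace 𝓘(ℝ, E) x) :
    MDifferentiableAt 𝓘(ℝ, E) 𝓘(ℝ, 𝕜) (fun y ↦ ∑ i ∈ s, c i y) x ∧
      mvfderiv 𝓘(ℝ, E) (fun y ↦ ∑ i ∈ s, c i y) x v = ∑ i ∈ s, mvfderiv 𝓘(ℝ, E) (c i) x v := by
  classical
  induction s using Finset.induction_on with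
  | empty =>
    simp only [Finset.sum_empty]
    exact ⟨mdifferentiableAt_const, by rw [mvfderiv_const]; rfl⟩
  | insert i s hi ih =>
    obtain ⟨h1, h2⟩ := ih fun j hj ↦ hc j (Finset.mem_insert_of_mem hj)
    have h3 := hc i (Finset.mem_insert_self i s)
    have h4 : (fun y ↦ ∑ j ∈ insert i s, c j y) = c i + fun y ↦ ∑ j ∈ s, c j y := by
      ext y
      simp [Finset.sum_insert hi]
    rw [h4, mvfderiv_add h3 h1, add_apply, h2, Finset.sum_insert hi]
    exact ⟨h3.add h1, rfl⟩

theorem mvfderiv_mul_rclike {f f' : M → 𝕜} {x : M}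
    (hf : MDifferentiableAt 𝓘(ℝ, E) 𝓘(ℝ, 𝕜) f x) (hf' : MDifferentiableAt 𝓘(ℝ, E) 𝓘(ℝ, 𝕜) f' x)
    (v : TangentSpace 𝓘(ℝ, E) x) :
    MDifferentiableAt 𝓘(ℝ, E) 𝓘(ℝ, 𝕜) (fun y ↦ f y * f' y) x ∧
      mvfderiv 𝓘(ℝ, E) (fun y ↦ f y * f' y) x v
        = mvfderiv 𝓘(ℝ, E) f x v * f' x + f x * mvfderiv 𝓘(ℝ, E) f' x v := by
  have h := hf.hasMFDerivAt.mul hf'.hasMFDerivAt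
  refine ⟨h.mdifferentiableAt, ?_⟩
  have h1 := DFunLike.congr_fun h.mfderiv v
  refine h1.trans ?_
  exact (add_comm _ _).trans (congrArg₂ _ (mul_comm _ _) rfl)

/-- Derivatives can be computed with arbitrary coefficient representations. -/
theorem coordDeriv_of_sum {ι : Type*} (s : Finset ι) {c : ι → M → 𝕜} {w : ι → W} {h : M → W} {x : M}
    (hc : ∀ i ∈ s, MDifferentiableAt 𝓘(ℝ, E) 𝓘(ℝ, 𝕜) (c i) x)
    (hh : ∀ᶠ y in 𝓝 x, h y = ∑ i ∈ s, c i y • w i) (v : TangentSpace 𝓘(ℝ, E) x) :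
    CoordDiffAt 𝕜 E h x ∧
      coordDeriv 𝕜 E h x v = ∑ i ∈ s, mvfderiv 𝓘(ℝ, E) (c i) x v • w i := by
  set B := Module.finBasis 𝕜 W with hB
  have h1 (j) : (fun y ↦ B.repr (h y) j) =ᶠ[𝓝 x] fun y ↦ ∑ i ∈ s, c i y * B.repr (w i) j := by
    filter_upwards [hh] with y hy
    simp [hy]
  have h2 (j) := mvfderiv_sum s (c := fun i y ↦ c i y * B.repr (w i) j)
    (fun i hi ↦ (mvfderiv_mul_rclike (hc i hi) mdifferentiableAt_const v).1) v
  refine ⟨fun j ↦ ((h2 j).1.congr_of_eventuallyEq (h1 j)), ?_⟩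
  have h3 (j) : mvfderiv 𝓘(ℝ, E) (fun y ↦ B.repr (h y) j) x v
      = ∑ i ∈ s, mvfderiv 𝓘(ℝ, E) (c i) x v * B.repr (w i) j := by
    rw [mvfderiv_congr (h1 j), (h2 j).2]
    refine Finset.sum_congr rfl fun i hi ↦ ?_
    rw [(mvfderiv_mul_rclike (hc i hi) mdifferentiableAt_const v).2, mvfderiv_const]
    simp
  rw [coordDeriv]
  simp only [← hB, h3, Finset.sum_smul, mul_smul]
  rw [Finset.sum_comm]
  refine Finset.sum_congr rfl fun i _ ↦ ?_
  rw [← Finset.smul_sum, B.sum_repr]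

theorem coordDeriv_congr {h h' : M → W} {x : M} (hh : ∀ᶠ y in 𝓝 x, h y = h' y) :
    coordDeriv 𝕜 E h x = coordDeriv 𝕜 E h' x := by
  ext v
  refine Finset.sum_congr rfl fun i _ ↦ ?_
  rw [mvfderiv_congr (hh.mono fun y hy ↦ by rw [hy])]

theorem CoordDiffAt.congr {h h' : M → W} {x : M} (h0 : CoordDiffAt 𝕜 E h x)
    (hh : ∀ᶠ y in 𝓝 x, h' y = h y) : CoordDiffAt 𝕜 E h' x :=
  fun i ↦ (h0 i).congr_of_eventuallyEq (hh.mono fun y hy ↦ by simp only [hy])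

/-- The coordinates of `h` serve as coefficients for the images under `L` of the basis vectors,
which need not be a basis; `coordDeriv_of_sum` allows any such representation. -/
theorem CoordDiffAt.linear_comp {h : M → W} {x : M} (h0 : CoordDiffAt 𝕜 E h x) (L : W →ₗ[𝕜] W')
    (v : TangentSpace 𝓘(ℝ, E) x) :
    CoordDiffAt 𝕜 E (fun y ↦ L (h y)) x ∧
      coordDeriv 𝕜 E (fun y ↦ L (h y)) x v = L (coordDeriv 𝕜 E h x v) := by
  have := coordDeriv_of_sum Finset.univ (w := fun i ↦ L (Module.finBasis 𝕜 W i))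
    (h := fun y ↦ L (h y)) (fun i _ ↦ h0 i) (Filter.Eventually.of_forall fun y ↦
      (congrArg L ((Module.finBasis 𝕜 W).sum_repr (h y)).symm).trans (by
        rw [map_sum]; simp only [map_smul])) v
  refine ⟨this.1, this.2.trans ?_⟩
  simp [coordDeriv]

theorem CoordDiffAt.add {h h' : M → W} {x : M} (h0 : CoordDiffAt 𝕜 E h x)
    (h0' : CoordDiffAt 𝕜 E h' x) (v : TangentSpace 𝓘(ℝ, E) x) :
    CoordDiffAt 𝕜 E (fun y ↦ h y + h' y) x ∧
      coordDeriv 𝕜 E (fun y ↦ h y + h' y) x v = coordDeriv 𝕜 E h x v + coordDeriv 𝕜 E h' x v := by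
  have := coordDeriv_of_sum Finset.univ (w := Module.finBasis 𝕜 W) (h := fun y ↦ h y + h' y)
    (c := fun i y ↦ (Module.finBasis 𝕜 W).repr (h y) i + (Module.finBasis 𝕜 W).repr (h' y) i)
    (fun i _ ↦ (h0 i).add (h0' i)) (Filter.Eventually.of_forall fun y ↦ by
      simp only [add_smul, Finset.sum_add_distrib, Module.Basis.sum_repr]) v
  refine ⟨this.1, this.2.trans ?_⟩
  simp only [coordDeriv, ← Finset.sum_add_distrib, ← add_smul]
  refine Finset.sum_congr rfl fun i _ ↦ ?_
  congr 1
  exact DFunLike.congr_fun (mvfderiv_add (h0 i) (h0' i)) v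

/-- Products of coordinates are coefficients with respect to products of basis vectors, which
reduces the claim to the scalar product rule. -/
theorem CoordDiffAt.mul {A : Type*} [Ring A] [Algebra 𝕜 A] [Module.Finite 𝕜 A] {h h' : M → A} {x : M}
    (h0 : CoordDiffAt 𝕜 E h x) (h0' : CoordDiffAt 𝕜 E h' x) (v : TangentSpace 𝓘(ℝ, E) x) :
    CoordDiffAt 𝕜 E (fun y ↦ h y * h' y) x ∧
      coordDeriv 𝕜 E (fun y ↦ h y * h' y) x v
        = coordDeriv 𝕜 E h x v * h' x + h x * coordDeriv 𝕜 E h' x v := by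
  let B := Module.finBasis 𝕜 A
  have hs (y : M) (k : M → A) : k y = ∑ i, B.repr (k y) i • B i := (B.sum_repr _).symm
  have := coordDeriv_of_sum (Finset.univ ×ˢ Finset.univ) (w := fun p ↦ B p.1 * B p.2)
    (h := fun y ↦ h y * h' y) (c := fun p y ↦ B.repr (h y) p.1 * B.repr (h' y) p.2)
    (fun p _ ↦ (mvfderiv_mul_rclike (h0 p.1) (h0' p.2) v).1) (Filter.Eventually.of_forall fun y ↦ by
      conv_lhs => rw [hs y h, hs y h']
      rw [Finset.sum_mul_sum, Finset.sum_product]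
      simp only [smul_mul_smul_comm]) v
  refine ⟨this.1, this.2.trans ?_⟩
  conv_rhs => rw [hs x h, hs x h']
  simp only [coordDeriv, Finset.sum_mul_sum, Finset.sum_product, smul_mul_smul_comm,
    ← Finset.sum_add_distrib]
  refine Finset.sum_congr rfl fun i _ ↦ Finset.sum_congr rfl fun j _ ↦ ?_
  rw [(mvfderiv_mul_rclike (h0 i) (h0' j) v).2, add_smul]

end CoordDeriv

instance exteriorAlgebra_finite {𝕜 V : Type*} [Field 𝕜] [AddCommGroup V] [Module 𝕜 V]
    [Module.Finite 𝕜 V] : Module.Finite 𝕜 (ExteriorAlgebra 𝕜 V) :=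
  Module.Finite.of_basis (Module.finBasis 𝕜 V).ExteriorAlgebra

/-! ### The even derivation `D_v` on sections of `ΛS` -/

section SuperDerivative

variable {𝕜 : Type*} [RCLike 𝕜]
  {E : Type*} [NormedAddCommGroup E] [NormedSpace ℝ E] [FiniteDimensional ℝ E]
  {M : Type*} [TopologicalSpace M] [ChartedSpace E M] [IsManifold 𝓘(ℝ, E) ∞ M]
  {F : Type*} [NormedAddCommGroup F] [NormedSpace ℝ F] [NormedSpace 𝕜 F] [IsScalarTower ℝ 𝕜 F]
  [FiniteDimensional ℝ F] [FiniteDimensional 𝕜 F]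
  {S : M → Type*} [TopologicalSpace (TotalSpace F S)]
  [∀ x, AddCommGroup (S x)] [∀ x, Module ℝ (S x)] [∀ x, Module 𝕜 (S x)]
  [∀ x, IsScalarTower ℝ 𝕜 (S x)]
  [∀ x, TopologicalSpace (S x)] [∀ x, IsTopologicalAddGroup (S x)] [∀ x, ContinuousSMul ℝ (S x)]
  [FiberBundle F S] [VectorBundle ℝ F S] [VectorBundle 𝕜 F S]
  [ContMDiffVectorBundle ∞ F S 𝓘(ℝ, E)]

/-- Coordinate functionals on `F` are continuous and linear, so they commute with the derivative. -/
theorem coordDeriv_eq_mvfderiv {h : M → F} {x : M} (hh : MDifferentiableAt 𝓘(ℝ, E) 𝓘(ℝ, F) h x)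
    (v : TangentSpace 𝓘(ℝ, E) x) :
    CoordDiffAt 𝕜 E h x ∧ coordDeriv 𝕜 E h x v = mvfderiv 𝓘(ℝ, E) h x v := by
  let B := Module.finBasis 𝕜 F
  let L (i) : F →L[ℝ] 𝕜 := LinearMap.toContinuousLinearMap ((B.coord i).restrictScalars ℝ)
  have hL (i) (w : F) : B.repr w i = L i w := rfl
  constructor
  · intro i
    exact (L i).contMDiff.contMDiffAt.mdifferentiableAt (n := 1) (by simp) |>.comp x hh
  · have h1 (i) : mvfderiv 𝓘(ℝ, E) (fun y ↦ B.repr (h y) i) x v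
        = B.repr (mvfderiv 𝓘(ℝ, E) h x v) i := mvfderiv_clm_comp (L i) hh v
    exact (Finset.sum_congr rfl fun i _ ↦ congrArg (· • B i) (h1 i)).trans (B.sum_repr _)

variable (F) in
/-- A family of elements of the exterior algebras `Λ(S y)`, read in the trivialization of `S`
around `x`. -/
def readSuper (x : M) (α : Π y : M, ExteriorAlgebra 𝕜 (S y)) (y : M) : ExteriorAlgebra 𝕜 F :=
  ExteriorAlgebra.map ((trivializationAt F S x).linearMapAt 𝕜 y) (α y)

variable (E F) in
/-- Differentiability at `x` of a section of `ΛS`. -/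
def SuperDiffAt (α : Π y : M, ExteriorAlgebra 𝕜 (S y)) (x : M) : Prop :=
  CoordDiffAt 𝕜 E (readSuper F x α) x

variable (𝕜 F) in
theorem extend_eventuallyEq_symmₗ {x : M} (s : S x) :
    ∀ᶠ y in 𝓝 x, FiberBundle.extend F s y = (trivializationAt F S x).symmₗ 𝕜 y
      ((trivializationAt F S x).linearMapAt 𝕜 x s) := by
  filter_upwards [(trivializationAt F S x).open_baseSet.mem_nhds
    (FiberBundle.mem_baseSet_trivializationAt' x)] with y hy
  rw [Trivialization.coe_linearMapAt_of_mem _ (FiberBundle.mem_baseSet_trivializationAt' x),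
    Trivialization.symmₗ_apply _ hy]
  rfl

/-- The zeroth order part of `D_v` with respect to the trivialization around `x`. -/
def SpinorConnection.connForm (D : SpinorConnection 𝕜 E F S) (x : M) (v : TangentSpace 𝓘(ℝ, E) x) :
    S x →ₗ[𝕜] S x where
  toFun s := D.toFun (FiberBundle.extend F s) x v
  map_add' s s' := by
    have hs := FiberBundle.mdifferentiableAt_extend 𝓘(ℝ, E) F s
    have hs' := FiberBundle.mdifferentiableAt_extend 𝓘(ℝ, E) F s'
    have h := D.isCovariantDerivativeOnUniv.add hs hs'
    rw [D.toFun_congr (FiberBundle.mdifferentiableAt_extend 𝓘(ℝ, E) F (s + s'))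
      (ψ' := FiberBundle.extend F s + FiberBundle.extend F s')] at h
    · exact congrArg (fun L ↦ L v) h
    -- Near `x` the extension depends linearly on the vector, because there it is the inverse
    -- trivialization of constant coordinates.
    · filter_upwards [extend_eventuallyEq_symmₗ 𝕜 F s, extend_eventuallyEq_symmₗ 𝕜 F s',
        extend_eventuallyEq_symmₗ 𝕜 F (s + s')] with y h1 h2 h3
      rw [Pi.add_apply, h1, h2, h3, map_add, map_add]
  map_smul' c s := by
    have h := D.map_const_smul c (FiberBundle.mdifferentiableAt_extend 𝓘(ℝ, E) F s) v
    rw [D.toFun_congr (FiberBundle.mdifferentiableAt_extend 𝓘(ℝ, E) F (c • s))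
      (ψ' := fun y ↦ c • FiberBundle.extend F s y)] at h
    · exact h
    · filter_upwards [extend_eventuallyEq_symmₗ 𝕜 F s, extend_eventuallyEq_symmₗ 𝕜 F (c • s)]
        with y h1 h2
      rw [h1, h2, map_smul, map_smul]

/-- The even derivation of sections of `ΛS` which acts on functions as `v` and on spinors as
`D_v`. -/
def superDeriv (D : SpinorConnection 𝕜 E F S) (x : M) (v : TangentSpace 𝓘(ℝ, E) x)
    (α : Π y : M, ExteriorAlgebra 𝕜 (S y)) : ExteriorAlgebra 𝕜 (S x) :=
  ExteriorAlgebra.map ((trivializationAt F S x).symmₗ 𝕜 x) (coordDeriv 𝕜 E (readSuper F x α) x v)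
    + exteriorDerivation (D.connForm x v) (α x)

variable {D : SpinorConnection 𝕜 E F S} {x : M}

theorem map_symmₗ_readSuper (α : Π y : M, ExteriorAlgebra 𝕜 (S y)) :
    ExteriorAlgebra.map ((trivializationAt F S x).symmₗ 𝕜 x) (readSuper F x α x) = α x := by
  have h : (ExteriorAlgebra.map ((trivializationAt F S x).symmₗ 𝕜 x)).comp
      (ExteriorAlgebra.map ((trivializationAt F S x).linearMapAt 𝕜 x)) = AlgHom.id 𝕜 _ := by
    ext s
    simp [Trivialization.symmₗ_linearMapAt _ (FiberBundle.mem_baseSet_trivializationAt' x)]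
  exact AlgHom.congr_fun h (α x)

theorem readSuper_congr {α β : Π y : M, ExteriorAlgebra 𝕜 (S y)} (h : ∀ᶠ y in 𝓝 x, α y = β y) :
    ∀ᶠ y in 𝓝 x, readSuper F x α y = readSuper F x β y := by
  filter_upwards [h] with y hy
  rw [readSuper, hy, readSuper]

theorem SuperDiffAt.congr {α β : Π y : M, ExteriorAlgebra 𝕜 (S y)} (hβ : SuperDiffAt E F β x)
    (h : ∀ᶠ y in 𝓝 x, α y = β y) : SuperDiffAt E F α x :=
  CoordDiffAt.congr hβ (readSuper_congr h)

theorem superDeriv_congr {α β : Π y : M, ExteriorAlgebra 𝕜 (S y)} (h : ∀ᶠ y in 𝓝 x, α y = β y)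
    (v : TangentSpace 𝓘(ℝ, E) x) : superDeriv D x v α = superDeriv D x v β := by
  rw [superDeriv, superDeriv, coordDeriv_congr (readSuper_congr h), h.self_of_nhds]

theorem superDeriv_add {α β : Π y : M, ExteriorAlgebra 𝕜 (S y)} (hα : SuperDiffAt E F α x)
    (hβ : SuperDiffAt E F β x) (v : TangentSpace 𝓘(ℝ, E) x) :
    SuperDiffAt E F (α + β) x ∧
      superDeriv D x v (α + β) = superDeriv D x v α + superDeriv D x v β := by
  have h0 : readSuper F x (α + β) = fun y ↦ readSuper F x α y + readSuper F x β y := by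
    ext y
    simp [readSuper]
  obtain ⟨h1, h2⟩ := CoordDiffAt.add hα hβ v
  refine ⟨by rw [SuperDiffAt, h0]; exact h1, ?_⟩
  rw [superDeriv, h0, h2, superDeriv, superDeriv]
  simp only [map_add, Pi.add_apply]
  abel

/-- Reading in the trivialization and transporting back are algebra homomorphisms, so the coordinate
part obeys the Leibniz rule; the zeroth order part does because it is a derivation. -/
theorem superDeriv_mul {α β : Π y : M, ExteriorAlgebra 𝕜 (S y)} (hα : SuperDiffAt E F α x)
    (hβ : SuperDiffAt E F β x) (v : TangentSpace 𝓘(ℝ, E) x) :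
    SuperDiffAt E F (α * β) x ∧
      superDeriv D x v (α * β) = superDeriv D x v α * β x + α x * superDeriv D x v β := by
  have h0 : readSuper F x (α * β) = fun y ↦ readSuper F x α y * readSuper F x β y := by
    ext y
    simp [readSuper]
  obtain ⟨h1, h2⟩ := CoordDiffAt.mul hα hβ v
  refine ⟨by rw [SuperDiffAt, h0]; exact h1, ?_⟩
  rw [superDeriv, h0, h2, superDeriv, superDeriv]
  simp only [map_add, map_mul, Pi.mul_apply, map_symmₗ_readSuper, exteriorDerivation_mul]
  noncomm_ring

theorem superDeriv_smul {α : Π y : M, ExteriorAlgebra 𝕜 (S y)} (hα : SuperDiffAt E F α x) (c : 𝕜)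
    (v : TangentSpace 𝓘(ℝ, E) x) :
    superDeriv D x v (c • α) = c • superDeriv D x v α := by
  have h0 : readSuper F x (c • α) = fun y ↦ (c • LinearMap.id (R := 𝕜)) (readSuper F x α y) := by
    ext y
    simp [readSuper]
  rw [superDeriv, h0, (CoordDiffAt.linear_comp hα _ v).2, superDeriv]
  simp

theorem superDeriv_function {f : M → 𝕜} (hf : MDifferentiableAt 𝓘(ℝ, E) 𝓘(ℝ, 𝕜) f x)
    (v : TangentSpace 𝓘(ℝ, E) x) :
    SuperDiffAt E F (fun y : M ↦ algebraMap 𝕜 (ExteriorAlgebra 𝕜 (S y)) (f y)) x ∧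
      superDeriv D x v (fun y ↦ algebraMap 𝕜 (ExteriorAlgebra 𝕜 (S y)) (f y))
        = algebraMap 𝕜 _ (mvfderiv 𝓘(ℝ, E) f x v) := by
  obtain ⟨h1, h2⟩ := coordDeriv_of_sum (E := E) (Finset.univ : Finset Unit) (c := fun _ ↦ f)
    (w := fun _ ↦ (1 : ExteriorAlgebra 𝕜 F))
    (h := readSuper F x fun y : M ↦ algebraMap 𝕜 (ExteriorAlgebra 𝕜 (S y)) (f y)) (fun _ _ ↦ hf)
    (Filter.Eventually.of_forall fun y ↦ by simp [readSuper, Algebra.algebraMap_eq_smul_one]) v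
  refine ⟨h1, ?_⟩
  rw [superDeriv, h2, exteriorDerivation_algebraMap]
  simp [Algebra.algebraMap_eq_smul_one]

/-- The two parts of `superDeriv` in degree one are the two summands of
`SpinorConnection.toFun_apply_eq`. -/
theorem superDeriv_spinor {ψ : Π y : M, S y} (hψ : MDiffAt (T% ψ) x)
    (v : TangentSpace 𝓘(ℝ, E) x) :
    SuperDiffAt E F (fun y : M ↦ ExteriorAlgebra.ι 𝕜 (ψ y)) x ∧
      superDeriv D x v (fun y ↦ ExteriorAlgebra.ι 𝕜 (ψ y))
        = ExteriorAlgebra.ι 𝕜 (D.toFun ψ x v) := by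
  have h0 := mdifferentiableAt_linearMapAt 𝕜 hψ
  obtain ⟨h1, h2⟩ := coordDeriv_eq_mvfderiv (𝕜 := 𝕜) h0 v
  obtain ⟨h3, h4⟩ := h1.linear_comp (ExteriorAlgebra.ι 𝕜) v
  have h5 : readSuper F x (fun y : M ↦ ExteriorAlgebra.ι 𝕜 (ψ y))
      = fun y ↦ ExteriorAlgebra.ι 𝕜 ((trivializationAt F S x).linearMapAt 𝕜 y (ψ y)) := by
    ext y
    simp [readSuper]
  refine ⟨by rw [SuperDiffAt, h5]; exact h3, ?_⟩
  rw [superDeriv, h5, h4, h2, D.toFun_apply_eq 𝕜 hψ v, map_add]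
  simp [SpinorConnection.connForm]

/-- In a trivialization parity is a constant linear map, so it commutes with the coordinate part; it
commutes with the induced derivation because the latter preserves degree. -/
theorem superDeriv_parity {α : Π y : M, ExteriorAlgebra 𝕜 (S y)} (hα : SuperDiffAt E F α x)
    (v : TangentSpace 𝓘(ℝ, E) x) :
    superDeriv D x v (fun y ↦ parity y (α y)) = parity x (superDeriv D x v α) := by
  have h0 : readSuper F x (fun y ↦ parity y (α y)) = fun y ↦
      (CliffordAlgebra.involute : ExteriorAlgebra 𝕜 F →ₐ[𝕜] ExteriorAlgebra 𝕜 F).toLinearMap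
        (readSuper F x α y) := by
    ext y
    exact (involute_map _ _).symm
  rw [superDeriv, h0, (CoordDiffAt.linear_comp hα _ v).2, superDeriv]
  simp only [AlgHom.toLinearMap_apply, parity, map_add]
  rw [involute_map, involute_exteriorDerivation]

/-- Near a point a superfunction is a polynomial in functions and spinors. Differentiability comes
paired with a formula for the derivative in some direction, for which the zero vector is taken. -/
theorem superDiffAt_of_mem (D : SpinorConnection 𝕜 E F S) (x : M)
    {α : Π y : M, ExteriorAlgebra 𝕜 (S y)} (hα : α ∈ SuperFunctions 𝕜 E F S) :
    SuperDiffAt E F α x := by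
  obtain ⟨α', hα', h⟩ := hα x
  refine SuperDiffAt.congr ?_ h
  clear h hα
  induction hα' using Algebra.adjoin_induction with
  | mem β hβ =>
    rcases hβ with ⟨f, hf, rfl⟩ | ⟨ψ, hψ, rfl⟩
    · exact (superDeriv_function (D := D) (hf.mdifferentiable (by simp) x) 0).1
    · exact (superDeriv_spinor (D := D) (hψ.mdifferentiable (by simp) x) 0).1
  | algebraMap c => exact (superDeriv_function (D := D) (f := fun _ ↦ c) mdifferentiableAt_const 0).1
  | add β β' _ _ h h' => exact (superDeriv_add (D := D) h h' 0).1
  | mul β β' _ _ h h' => exact (superDeriv_mul (D := D) h h' 0).1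

end SuperDerivative

/-! ### The odd vector field `γ^μ η ⊗ D_μ`: existence, locality, uniqueness -/

section OddDerivation

variable {𝕜 : Type*} [RCLike 𝕜]
  {E : Type*} [NormedAddCommGroup E] [NormedSpace ℝ E] [FiniteDimensional ℝ E]
  {M : Type*} [TopologicalSpace M] [ChartedSpace E M] [IsManifold 𝓘(ℝ, E) ∞ M]
  {F : Type*} [NormedAddCommGroup F] [NormedSpace ℝ F] [NormedSpace 𝕜 F] [IsScalarTower ℝ 𝕜 F]
  [FiniteDimensional ℝ F] [FiniteDimensional 𝕜 F]
  {S : M → Type*} [TopologicalSpace (TotalSpace F S)]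
  [∀ x, AddCommGroup (S x)] [∀ x, Module ℝ (S x)] [∀ x, Module 𝕜 (S x)]
  [∀ x, IsScalarTower ℝ 𝕜 (S x)]
  [∀ x, TopologicalSpace (S x)] [∀ x, IsTopologicalAddGroup (S x)] [∀ x, ContinuousSMul ℝ (S x)]
  [FiberBundle F S] [VectorBundle ℝ F S] [VectorBundle 𝕜 F S]
  [ContMDiffVectorBundle ∞ F S 𝓘(ℝ, E)]

  {g : PseudoRiemannianMetric E M}

/-- The map `v ↦ v · s` with values in the odd elements of degree one. -/
def CliffordMultiplication.mulι (γ : CliffordMultiplication 𝕜 g F S) {x : M} (s : S x) :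
    TangentSpace 𝓘(ℝ, E) x →ₗ[ℝ] ExteriorAlgebra 𝕜 (S x) where
  toFun v := ExteriorAlgebra.ι 𝕜 (γ.mul x v s)
  map_add' v w := by simp
  map_smul' c v := by
    rw [map_smul, smul_apply, ← algebraMap_smul 𝕜 c, map_smul, algebraMap_smul, RingHom.id_apply]

theorem CliffordMultiplication.mulι_apply (γ : CliffordMultiplication 𝕜 g F S) {x : M} (s : S x)
    (v : TangentSpace 𝓘(ℝ, E) x) : γ.mulι s v = ExteriorAlgebra.ι 𝕜 (γ.mul x v s) :=
  rfl

theorem CliffordMultiplication.contract_mulι_mul (γ : CliffordMultiplication 𝕜 g F S) {x : M}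
    {e e' : Fin (Module.finrank ℝ E) → TangentSpace 𝓘(ℝ, E) x}
    (h : ∀ μ ν, g.val x (e' μ) (e ν) = if μ = ν then 1 else 0) (s : S x)
    (L : TangentSpace 𝓘(ℝ, E) x →ₗ[ℝ] ExteriorAlgebra 𝕜 (S x)) :
    g.contract x (fun v w ↦ γ.mulι s v * L w) = ∑ μ, γ.mulι s (e' μ) * L (e μ) :=
  g.contract_eq_sum_of_dual h ((LinearMap.mul ℝ (ExteriorAlgebra 𝕜 (S x))).compl₁₂ (γ.mulι s) L)

/-- The action of `γ^μ η ⊗ D_μ` on sections of `ΛS`. -/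
def imathFun (γ : CliffordMultiplication 𝕜 g F S) (D : SpinorConnection 𝕜 E F S)
    (η : Π x : M, S x) (α : Π x : M, ExteriorAlgebra 𝕜 (S x)) (x : M) : ExteriorAlgebra 𝕜 (S x) :=
  g.contract x fun v w ↦ γ.mulι (η x) v * superDeriv D x w α

variable {γ : CliffordMultiplication 𝕜 g F S} {D : SpinorConnection 𝕜 E F S}
  {η : Π x : M, S x}

theorem imathFun_congr {α β : Π y : M, ExteriorAlgebra 𝕜 (S y)} {x : M}
    (h : ∀ᶠ y in 𝓝 x, α y = β y) : imathFun γ D η α x = imathFun γ D η β x := by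
  simp only [imathFun, superDeriv_congr h]

theorem imathFun_add {α β : Π y : M, ExteriorAlgebra 𝕜 (S y)} {x : M} (hα : SuperDiffAt E F α x)
    (hβ : SuperDiffAt E F β x) :
    imathFun γ D η (α + β) x = imathFun γ D η α x + imathFun γ D η β x := by
  simp only [imathFun, PseudoRiemannianMetric.contract, (superDeriv_add hα hβ _).2, mul_add,
    Finset.sum_add_distrib]

theorem imathFun_smul {α : Π y : M, ExteriorAlgebra 𝕜 (S y)} {x : M} (hα : SuperDiffAt E F α x)
    (c : 𝕜) : imathFun γ D η (c • α) x = c • imathFun γ D η α x := by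
  simp only [imathFun, PseudoRiemannianMetric.contract, superDeriv_smul hα, mul_smul_comm,
    Finset.smul_sum]

/-- The even derivation `D_μ` gives two terms; in the second, `γ^μ η` is moved to the right of `α`,
which turns `α` into its image under the grading involution. -/
theorem imathFun_mul {α β : Π y : M, ExteriorAlgebra 𝕜 (S y)} {x : M} (hα : SuperDiffAt E F α x)
    (hβ : SuperDiffAt E F β x) :
    imathFun γ D η (α * β) x
      = imathFun γ D η α x * β x + parity x (α x) * imathFun γ D η β x := by
  simp only [imathFun, PseudoRiemannianMetric.contract, (superDeriv_mul hα hβ _).2, mul_add,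
    Finset.sum_add_distrib, Finset.sum_mul, Finset.mul_sum, ← mul_assoc, parity,
    CliffordMultiplication.mulι_apply, ι_mul_eq_involute_mul_ι _ (α x)]

theorem parity_imathFun {α : Π y : M, ExteriorAlgebra 𝕜 (S y)} {x : M}
    (hα : SuperDiffAt E F α x) :
    parity x (imathFun γ D η α x) = -imathFun γ D η (fun y ↦ parity y (α y)) x := by
  simp only [imathFun, PseudoRiemannianMetric.contract, superDeriv_parity hα, map_sum, map_mul,
    CliffordMultiplication.mulι_apply, ← Finset.sum_neg_distrib]
  refine Finset.sum_congr rfl fun μ _ ↦ ?_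
  rw [← neg_mul]
  congr 1
  exact CliffordAlgebra.involute_ι _

theorem imathFun_function {f : M → 𝕜} {x : M} (hf : MDifferentiableAt 𝓘(ℝ, E) 𝓘(ℝ, 𝕜) f x) :
    imathFun γ D η (fun y ↦ algebraMap 𝕜 (ExteriorAlgebra 𝕜 (S y)) (f y)) x
      = g.contract x fun v w ↦ mvfderiv 𝓘(ℝ, E) f x w • ExteriorAlgebra.ι 𝕜 (γ.mul x v (η x)) := by
  simp only [imathFun, (superDeriv_function hf _).2, CliffordMultiplication.mulι_apply,
    ← Algebra.commutes, ← Algebra.smul_def]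

theorem imathFun_spinor {ψ : Π y : M, S y} {x : M} (hψ : MDiffAt (T% ψ) x) :
    imathFun γ D η (fun y ↦ ExteriorAlgebra.ι 𝕜 (ψ y)) x
      = g.contract x fun v w ↦
        ExteriorAlgebra.ι 𝕜 (γ.mul x v (η x)) * ExteriorAlgebra.ι 𝕜 (D.toFun ψ x w) := by
  simp only [imathFun, (superDeriv_spinor hψ _).2, CliffordMultiplication.mulι_apply]

/-- The derivatives of a function as elements of degree zero. -/
def derivFunction (f : M → 𝕜) (x : M) :
    TangentSpace 𝓘(ℝ, E) x →ₗ[ℝ] ExteriorAlgebra 𝕜 (S x) where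
  toFun v := algebraMap 𝕜 _ (mvfderiv 𝓘(ℝ, E) f x v)
  map_add' v w := by simp
  map_smul' c v := by
    rw [map_smul, RingHom.id_apply, RCLike.real_smul_eq_coe_mul, map_mul, ← Algebra.smul_def]
    exact algebraMap_smul 𝕜 c _

/-- The derivatives of a spinor field as elements of degree one. -/
def derivSpinor (D : SpinorConnection 𝕜 E F S) (ψ : Π y : M, S y) (x : M) :
    TangentSpace 𝓘(ℝ, E) x →ₗ[ℝ] ExteriorAlgebra 𝕜 (S x) where
  toFun v := ExteriorAlgebra.ι 𝕜 (D.toFun ψ x v)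
  map_add' v w := by simp
  map_smul' c v := by
    rw [map_smul, ← algebraMap_smul 𝕜 c, map_smul, algebraMap_smul, RingHom.id_apply]

theorem superFunctions_of_eventually {α : Π y : M, ExteriorAlgebra 𝕜 (S y)}
    (h : ∀ x, ∃ β ∈ SuperFunctions 𝕜 E F S, ∀ᶠ y in 𝓝 x, α y = β y) :
    α ∈ SuperFunctions 𝕜 E F S := by
  intro x
  obtain ⟨β, hβ, h1⟩ := h x
  obtain ⟨β', hβ', h2⟩ := hβ x
  exact ⟨β', hβ', h1.mp (h2.mono fun y h2 h1 ↦ h1.trans h2)⟩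

theorem mem_superFunctions_of_adjoin {α : Π y : M, ExteriorAlgebra 𝕜 (S y)}
    (h : α ∈ Algebra.adjoin 𝕜 (generators 𝕜 E F S)) : α ∈ SuperFunctions 𝕜 E F S :=
  fun _ ↦ ⟨α, h, Filter.Eventually.of_forall fun _ ↦ rfl⟩

/-- The involution is an algebra homomorphism that fixes functions and negates spinors, so it
preserves polynomials in them. -/
theorem parity_mem_superFunctions {α : Π y : M, ExteriorAlgebra 𝕜 (S y)}
    (hα : α ∈ SuperFunctions 𝕜 E F S) : (fun y ↦ parity y (α y)) ∈ SuperFunctions 𝕜 E F S := by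
  refine superFunctions_of_eventually fun x ↦ ?_
  obtain ⟨β, hβ, h⟩ := hα x
  refine ⟨fun y ↦ parity y (β y), ?_, h.mono fun y hy ↦ by rw [hy]⟩
  clear h
  induction hβ using Algebra.adjoin_induction with
  | mem β hβ =>
    rcases hβ with ⟨f, hf, rfl⟩ | ⟨ψ, hψ, rfl⟩
    · convert (ofFunction f hf : SuperFunctions 𝕜 E F S).2 using 1
      ext y
      exact AlgHom.commutes _ _
    · have := neg_mem (ofSpinor ψ hψ : SuperFunctions 𝕜 E F S).2
      convert this using 1
      ext y
      exact CliffordAlgebra.involute_ι _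
  | algebraMap c =>
    convert Subalgebra.algebraMap_mem (SuperFunctions 𝕜 E F S) c using 1
    ext y
    exact AlgHom.commutes _ _
  | add β β' _ _ h h' =>
    convert add_mem h h' using 1
    ext y
    exact map_add _ _ _
  | mul β β' _ _ h h' =>
    convert mul_mem h h' using 1
    ext y
    exact map_mul _ _ _

/-- Near a point, `γ^μ η ⊗ D_μ` can be computed with smooth dual frames. -/
theorem imathFun_eq_sum {x : M} {e e' : Fin (Module.finrank ℝ E) → TangentSpace 𝓘(ℝ, E) x}
    (h : ∀ μ ν, g.val x (e' μ) (e ν) = if μ = ν then 1 else 0)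
    {α : Π y : M, ExteriorAlgebra 𝕜 (S y)}
    {L : TangentSpace 𝓘(ℝ, E) x →ₗ[ℝ] ExteriorAlgebra 𝕜 (S x)}
    (hL : ∀ v, superDeriv D x v α = L v) :
    imathFun γ D η α x = ∑ μ, γ.mulι (η x) (e' μ) * L (e μ) := by
  simp only [imathFun, hL]
  exact γ.contract_mulι_mul h _ L

/-- The basis used in `contract` need not vary smoothly with the point. Frame independence allows a
smooth dual frame near each point, which settles the generators; sums and products follow from the
Leibniz rule. -/
theorem imathFun_mem [T2Space M] (hη : ContMDiff 𝓘(ℝ, E) (𝓘(ℝ, E).prod 𝓘(ℝ, F)) ∞ (T% η))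
    {α : Π y : M, ExteriorAlgebra 𝕜 (S y)} (hα : α ∈ SuperFunctions 𝕜 E F S) :
    imathFun γ D η α ∈ SuperFunctions 𝕜 E F S := by
  have key (β : Π y : M, ExteriorAlgebra 𝕜 (S y))
      (L : Π y : M, TangentSpace 𝓘(ℝ, E) y →ₗ[ℝ] ExteriorAlgebra 𝕜 (S y))
      (hL : ∀ y v, superDeriv D y v β = L y v)
      (hL' : ∀ V : Π y : M, TangentSpace 𝓘(ℝ, E) y,
        ContMDiff 𝓘(ℝ, E) (𝓘(ℝ, E).prod 𝓘(ℝ, E)) ∞ (T% V) →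
          (fun y ↦ L y (V y)) ∈ SuperFunctions 𝕜 E F S) :
      imathFun γ D η β ∈ SuperFunctions 𝕜 E F S := by
    refine superFunctions_of_eventually fun x ↦ ?_
    obtain ⟨e, e', he, he', -, h⟩ := g.exists_dual_frame x
    refine ⟨∑ μ, (fun y ↦ γ.mulι (η y) (e' μ y)) * fun y ↦ L y (e μ y), sum_mem fun μ _ ↦ mul_mem
      (ofSpinor _ (γ.contMDiff_mul_apply (he' μ) hη)).2 (hL' _ (he μ)), ?_⟩
    filter_upwards [h] with y hy
    rw [imathFun_eq_sum hy (hL y)]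
    simp
  refine superFunctions_of_eventually fun x ↦ ?_
  obtain ⟨β, hβ, h⟩ := hα x
  refine ⟨imathFun γ D η β, ?_, h.eventually_nhds.mono fun y hy ↦ imathFun_congr hy⟩
  clear h
  have hfun (f : M → 𝕜) (hf : ContMDiff 𝓘(ℝ, E) 𝓘(ℝ, 𝕜) ∞ f) :
      imathFun γ D η (fun y ↦ algebraMap 𝕜 (ExteriorAlgebra 𝕜 (S y)) (f y))
        ∈ SuperFunctions 𝕜 E F S :=
    key _ (derivFunction f)
      (fun y v ↦ (superDeriv_function (hf.mdifferentiable (by simp) y) v).2)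
      fun V hV ↦ (ofFunction _ (contMDiff_mvfderiv_apply hf hV)).2
  induction hβ using Algebra.adjoin_induction with
  | mem β hβ =>
    rcases hβ with ⟨f, hf, rfl⟩ | ⟨ψ, hψ, rfl⟩
    · exact hfun f hf
    · exact key _ (derivSpinor D ψ)
        (fun y v ↦ (superDeriv_spinor (hψ.mdifferentiable (by simp) y) v).2)
        fun V hV ↦ (ofSpinor _ (D.contMDiff_apply hψ hV)).2
  | algebraMap c => exact hfun (fun _ ↦ c) contMDiff_const
  | add β β' hβ hβ' h h' =>
    have := add_mem h h'
    convert this using 1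
    ext y
    exact imathFun_add (superDiffAt_of_mem D y (mem_superFunctions_of_adjoin hβ))
      (superDiffAt_of_mem D y (mem_superFunctions_of_adjoin hβ'))
  | mul β β' hβ hβ' h h' =>
    have := add_mem (mul_mem h (mem_superFunctions_of_adjoin hβ'))
      (mul_mem (parity_mem_superFunctions (mem_superFunctions_of_adjoin hβ)) h')
    convert this using 1
    ext y
    exact imathFun_mul (superDiffAt_of_mem D y (mem_superFunctions_of_adjoin hβ))
      (superDiffAt_of_mem D y (mem_superFunctions_of_adjoin hβ'))

variable (γ D) in
/-- The odd vector field `γ^μ η ⊗ D_μ`. -/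
def imath [T2Space M] (hη : ContMDiff 𝓘(ℝ, E) (𝓘(ℝ, E).prod 𝓘(ℝ, F)) ∞ (T% η)) :
    OddVectorField 𝕜 E F S where
  toFun α := ⟨imathFun γ D η α.1, imathFun_mem hη α.2⟩
  map_add' α β := Subtype.ext <| funext fun x ↦
    imathFun_add (superDiffAt_of_mem D x α.2) (superDiffAt_of_mem D x β.2)
  map_smul' c α := Subtype.ext <| funext fun x ↦ imathFun_smul (superDiffAt_of_mem D x α.2) c
  odd_of_even α hα x := by
    refine (parity_imathFun (superDiffAt_of_mem D x α.2)).trans (congrArg Neg.neg ?_)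
    simp only [hα]
  even_of_odd α hα x := by
    refine (parity_imathFun (superDiffAt_of_mem D x α.2)).trans ?_
    have h : (fun y ↦ parity y (α.1 y)) = (-1 : 𝕜) • α.1 := by
      ext y
      simp [hα]
    rw [h, imathFun_smul (superDiffAt_of_mem D x α.2), neg_smul, one_smul, neg_neg]
  leibniz α β x := imathFun_mul (superDiffAt_of_mem D x α.2) (superDiffAt_of_mem D x β.2)

theorem isImath_imath [T2Space M]
    (hη : ContMDiff 𝓘(ℝ, E) (𝓘(ℝ, E).prod 𝓘(ℝ, F)) ∞ (T% η)) : IsImath γ D η (imath γ D hη) :=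
  ⟨fun _ hf x ↦ imathFun_function (hf.mdifferentiable (by simp) x),
    fun _ hψ x ↦ imathFun_spinor (hψ.mdifferentiable (by simp) x)⟩

/-- Locality by a cutoff `ρ` with `ρ = 1` near `x` and `ρ α = 0` everywhere: since `α` vanishes at
`x`, the Leibniz rule applied to `ρ α` leaves only the value of `Q α` at `x`. -/
theorem OddVectorField.apply_eq_zero [T2Space M] (Q : OddVectorField 𝕜 E F S)
    (α : SuperFunctions 𝕜 E F S) {x : M} (h : ∀ᶠ y in 𝓝 x, α.1 y = 0) : (Q.toFun α).1 x = 0 := by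
  obtain ⟨ρ, hρ, h1, h2⟩ := exists_smooth_cutoff (E := E) h
  have hρ' : ContMDiff 𝓘(ℝ, E) 𝓘(ℝ, 𝕜) ∞ fun y ↦ (ρ y : 𝕜) :=
    (RCLike.ofRealCLM (K := 𝕜)).contMDiff.comp hρ
  have h3 : ofFunction _ hρ' * α = 0 := by
    refine Subtype.ext (funext fun y ↦ ?_)
    change algebraMap 𝕜 _ (ρ y : 𝕜) * α.1 y = 0
    by_cases hy : α.1 y = 0
    · rw [hy, mul_zero]
    · rw [h2 y hy]
      simp
  have h4 := Q.leibniz (ofFunction _ hρ') α x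
  have h5 : Q.toFun 0 = 0 := Q.toLinearMap.map_zero
  have h6 : (ofFunction _ hρ' : SuperFunctions 𝕜 E F S).1 x = 1 := by
    change algebraMap 𝕜 _ (ρ x : 𝕜) = 1
    rw [h1.self_of_nhds]
    simp
  rw [h3, h5, h.self_of_nhds, h6, map_one, mul_zero, one_mul, zero_add] at h4
  exact h4.symm

theorem OddVectorField.apply_congr [T2Space M] (Q : OddVectorField 𝕜 E F S)
    {α β : SuperFunctions 𝕜 E F S} {x : M} (h : ∀ᶠ y in 𝓝 x, α.1 y = β.1 y) :
    (Q.toFun α).1 x = (Q.toFun β).1 x := by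
  have h1 : (Q.toFun (α - β)).1 x = 0 := Q.apply_eq_zero _ <| h.mono fun y hy ↦ sub_eq_zero.2 hy
  have h2 : Q.toFun (α - β) = Q.toFun α - Q.toFun β := Q.toLinearMap.map_sub α β
  rw [h2] at h1
  exact sub_eq_zero.1 h1

/-- Odd vector fields which agree on functions and on spinors agree. -/
theorem OddVectorField.toFun_ext [T2Space M] {Q Q' : OddVectorField 𝕜 E F S}
    (hf : ∀ (f : M → 𝕜) (hf : ContMDiff 𝓘(ℝ, E) 𝓘(ℝ, 𝕜) ∞ f),
      Q.toFun (ofFunction f hf) = Q'.toFun (ofFunction f hf))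
    (hψ : ∀ (ψ : Π x : M, S x) (hψ : ContMDiff 𝓘(ℝ, E) (𝓘(ℝ, E).prod 𝓘(ℝ, F)) ∞ (T% ψ)),
      Q.toFun (ofSpinor ψ hψ) = Q'.toFun (ofSpinor ψ hψ)) (α : SuperFunctions 𝕜 E F S) :
    Q.toFun α = Q'.toFun α := by
  refine Subtype.ext (funext fun x ↦ ?_)
  obtain ⟨β, hβ, h⟩ := α.2 x
  -- By locality it suffices to compare the two fields on a polynomial in the generators that agrees
  -- with `α` near `x`.
  have key : Q.toFun ⟨β, mem_superFunctions_of_adjoin hβ⟩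
      = Q'.toFun ⟨β, mem_superFunctions_of_adjoin hβ⟩ := by
    clear h
    induction hβ using Algebra.adjoin_induction with
    | mem β hβ =>
      rcases hβ with ⟨f, hf', rfl⟩ | ⟨ψ, hψ', rfl⟩
      · exact hf f hf'
      · exact hψ ψ hψ'
    | algebraMap c => exact hf (fun _ ↦ c) contMDiff_const
    | add β β' hβ hβ' h h' =>
      exact (Q.toLinearMap.map_add ⟨β, mem_superFunctions_of_adjoin hβ⟩
        ⟨β', mem_superFunctions_of_adjoin hβ'⟩).trans ((congrArg₂ _ h h').trans
          (Q'.toLinearMap.map_add ⟨β, mem_superFunctions_of_adjoin hβ⟩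
            ⟨β', mem_superFunctions_of_adjoin hβ'⟩).symm)
    | mul β β' hβ hβ' h h' =>
      refine Subtype.ext (funext fun y ↦ ?_)
      have h1 := Q.leibniz ⟨β, mem_superFunctions_of_adjoin hβ⟩
        ⟨β', mem_superFunctions_of_adjoin hβ'⟩ y
      have h2 := Q'.leibniz ⟨β, mem_superFunctions_of_adjoin hβ⟩
        ⟨β', mem_superFunctions_of_adjoin hβ'⟩ y
      rw [h, h'] at h1
      exact h1.trans h2.symm
  rw [Q.apply_congr (β := ⟨β, mem_superFunctions_of_adjoin hβ⟩) h, key,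
    Q'.apply_congr (β := ⟨β, mem_superFunctions_of_adjoin hβ⟩) h]

theorem IsImath.eq_imath [T2Space M]
    (hη : ContMDiff 𝓘(ℝ, E) (𝓘(ℝ, E).prod 𝓘(ℝ, F)) ∞ (T% η)) {Q : OddVectorField 𝕜 E F S}
    (hQ : IsImath γ D η Q) : Q = imath γ D hη := by
  have h : Q.toLinearMap = (imath γ D hη).toLinearMap := by
    refine LinearMap.ext fun α ↦ OddVectorField.toFun_ext (fun f hf ↦ ?_) (fun ψ hψ ↦ ?_) α
    · exact Subtype.ext (funext fun x ↦
        (hQ.1 f hf x).trans ((isImath_imath hη).1 f hf x).symm)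
    · exact Subtype.ext (funext fun x ↦
        (hQ.2 ψ hψ x).trans ((isImath_imath hη).2 ψ hψ x).symm)
  cases Q
  congr 1

end OddDerivation

/-! ### The square of `γ^μ η ⊗ D_μ` -/

section Square

variable {𝕜 : Type*} [RCLike 𝕜]
  {E : Type*} [NormedAddCommGroup E] [NormedSpace ℝ E] [FiniteDimensional ℝ E]
  {M : Type*} [TopologicalSpace M] [ChartedSpace E M] [IsManifold 𝓘(ℝ, E) ∞ M]
  {F : Type*} [NormedAddCommGroup F] [NormedSpace ℝ F] [NormedSpace 𝕜 F] [IsScalarTower ℝ 𝕜 F]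
  [FiniteDimensional ℝ F] [FiniteDimensional 𝕜 F]
  {S : M → Type*} [TopologicalSpace (TotalSpace F S)]
  [∀ x, AddCommGroup (S x)] [∀ x, Module ℝ (S x)] [∀ x, Module 𝕜 (S x)]
  [∀ x, IsScalarTower ℝ 𝕜 (S x)]
  [∀ x, TopologicalSpace (S x)] [∀ x, IsTopologicalAddGroup (S x)] [∀ x, ContinuousSMul ℝ (S x)]
  [FiberBundle F S] [VectorBundle ℝ F S] [VectorBundle 𝕜 F S]
  [ContMDiffVectorBundle ∞ F S 𝓘(ℝ, E)]

  {g : PseudoRiemannianMetric E M}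
  {γ : CliffordMultiplication 𝕜 g F S} {D : SpinorConnection 𝕜 E F S} {η : Π x : M, S x}

theorem parity_parity {x : M} (a : ExteriorAlgebra 𝕜 (S x)) : parity x (parity x a) = a :=
  CliffordAlgebra.involute_involute a

/-- The mixed terms cancel because the operator is odd: by `parity_imathFun` it anticommutes with
the grading involution. -/
theorem imathFun_imathFun_mul [T2Space M]
    (hη : ContMDiff 𝓘(ℝ, E) (𝓘(ℝ, E).prod 𝓘(ℝ, F)) ∞ (T% η))
    {α β : Π y : M, ExteriorAlgebra 𝕜 (S y)} (hα : α ∈ SuperFunctions 𝕜 E F S)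
    (hβ : β ∈ SuperFunctions 𝕜 E F S) (x : M) :
    imathFun γ D η (imathFun γ D η (α * β)) x
      = imathFun γ D η (imathFun γ D η α) x * β x + α x * imathFun γ D η (imathFun γ D η β) x := by
  have hd {δ : Π y : M, ExteriorAlgebra 𝕜 (S y)} (h : δ ∈ SuperFunctions 𝕜 E F S) (y : M) :
      SuperDiffAt E F δ y := superDiffAt_of_mem D y h
  have hα' : imathFun γ D η α ∈ SuperFunctions 𝕜 E F S := imathFun_mem hη hα
  have hβ' : imathFun γ D η β ∈ SuperFunctions 𝕜 E F S := imathFun_mem hη hβ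
  have hp := parity_mem_superFunctions hα
  have h0 : imathFun γ D η (α * β)
      = imathFun γ D η α * β + (fun y ↦ parity y (α y)) * imathFun γ D η β :=
    funext fun y ↦ imathFun_mul (hd hα y) (hd hβ y)
  rw [h0, imathFun_add (hd (mul_mem hα' hβ) x) (hd (mul_mem hp hβ') x),
    imathFun_mul (hd hα' x) (hd hβ x), imathFun_mul (hd hp x) (hd hβ' x),
    parity_imathFun (hd hα x), parity_parity]
  noncomm_ring

/-- The square is local and, by `imathFun_imathFun_mul`, a derivation, so generators suffice. -/
theorem imath_isDifferential [T2Space M]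
    (hη : ContMDiff 𝓘(ℝ, E) (𝓘(ℝ, E).prod 𝓘(ℝ, F)) ∞ (T% η))
    (hf : ∀ (f : M → 𝕜), ContMDiff 𝓘(ℝ, E) 𝓘(ℝ, 𝕜) ∞ f → ∀ x : M, imathFun γ D η
      (imathFun γ D η fun y ↦ algebraMap 𝕜 (ExteriorAlgebra 𝕜 (S y)) (f y)) x = 0)
    (hψ : ∀ (ψ : Π x : M, S x), ContMDiff 𝓘(ℝ, E) (𝓘(ℝ, E).prod 𝓘(ℝ, F)) ∞ (T% ψ) →
      ∀ x : M, imathFun γ D η (imathFun γ D η fun y ↦ ExteriorAlgebra.ι 𝕜 (ψ y)) x = 0) :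
    (imath γ D hη).IsDifferential := by
  intro α
  refine Subtype.ext (funext fun x ↦ ?_)
  change imathFun γ D η (imathFun γ D η α.1) x = 0
  obtain ⟨β, hβ, h⟩ := α.2 x
  rw [imathFun_congr (h.eventually_nhds.mono fun y hy ↦ imathFun_congr hy)]
  clear h
  induction hβ using Algebra.adjoin_induction with
  | mem β hβ =>
    rcases hβ with ⟨f, hf', rfl⟩ | ⟨ψ, hψ', rfl⟩
    · exact hf f hf' x
    · exact hψ ψ hψ' x
  | algebraMap c => exact hf (fun _ ↦ c) contMDiff_const x
  | add β β' hβ hβ' h h' =>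
    have hb := mem_superFunctions_of_adjoin hβ
    have hb' := mem_superFunctions_of_adjoin hβ'
    have h0 : imathFun γ D η (β + β') = imathFun γ D η β + imathFun γ D η β' :=
      funext fun y ↦ imathFun_add (superDiffAt_of_mem D y hb) (superDiffAt_of_mem D y hb')
    rw [h0, imathFun_add (superDiffAt_of_mem D x (imathFun_mem hη hb))
      (superDiffAt_of_mem D x (imathFun_mem hη hb')), h, h', add_zero]
  | mul β β' hβ hβ' h h' =>
    rw [imathFun_imathFun_mul hη (mem_superFunctions_of_adjoin hβ)
      (mem_superFunctions_of_adjoin hβ'), h, h', zero_mul, mul_zero, add_zero]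

theorem superDeriv_sum {x : M} {κ : Type*} (s : Finset κ)
    {α : κ → Π y : M, ExteriorAlgebra 𝕜 (S y)} (hα : ∀ i, SuperDiffAt E F (α i) x)
    (v : TangentSpace 𝓘(ℝ, E) x) :
    SuperDiffAt E F (∑ i ∈ s, α i) x ∧
      superDeriv D x v (∑ i ∈ s, α i) = ∑ i ∈ s, superDeriv D x v (α i) := by
  classical
  induction s using Finset.induction_on with
  | empty =>
    have h0 : (0 : Π y : M, ExteriorAlgebra 𝕜 (S y)) ∈ SuperFunctions 𝕜 E F S := zero_mem _
    have h1 := superDeriv_smul (D := D) (superDiffAt_of_mem D x h0) 0 v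
    rw [zero_smul, zero_smul] at h1
    exact ⟨superDiffAt_of_mem D x h0, h1⟩
  | insert i s hi ih =>
    rw [Finset.sum_insert hi, Finset.sum_insert hi, ← ih.2]
    exact superDeriv_add (hα i) ih.1 v

variable {C : ChargeConjugation γ}
  {nabla : CovariantDerivative 𝓘(ℝ, E) E (TangentSpace 𝓘(ℝ, E) : M → Type _)}

variable (D η C nabla) in
/-- The map `w ↦ γ^ν η ∧ (D̂_ν γ)(w) η`. -/
def torsionForm (x : M) : TangentSpace 𝓘(ℝ, E) x →ₗ[ℝ] ExteriorAlgebra 𝕜 (S x) :=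
  ∑ ν, (LinearMap.mulLeft ℝ (γ.mulι (η x) (g.coframe x ν))) ∘ₗ
    ((ExteriorAlgebra.ι 𝕜).restrictScalars ℝ) ∘ₗ (hatDBilin C D nabla x (η x)
      (PseudoRiemannianMetric.frame x ν))

theorem torsionForm_apply (x : M) (w : TangentSpace 𝓘(ℝ, E) x) :
    torsionForm D η C nabla x w = ∑ ν, γ.mulι (η x) (g.coframe x ν)
      * ExteriorAlgebra.ι 𝕜 (hatD C D nabla x (PseudoRiemannianMetric.frame x ν) w (η x)) := by
  simp [torsionForm, LinearMap.sum_apply]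

/-- The pairings of a frame with its dual are locally constant; differentiating them with the metric
connection gives the coefficients of `∇ e^μ`. -/
theorem nabla_dual_frame (hnabla : g.IsLeviCivita nabla) {x : M}
    {e e' : Fin (Module.finrank ℝ E) → Π y : M, TangentSpace 𝓘(ℝ, E) y}
    (he : ∀ μ, ContMDiff 𝓘(ℝ, E) (𝓘(ℝ, E).prod 𝓘(ℝ, E)) ∞ (T% (e μ)))
    (he' : ∀ μ, ContMDiff 𝓘(ℝ, E) (𝓘(ℝ, E).prod 𝓘(ℝ, E)) ∞ (T% (e' μ)))
    (h : ∀ᶠ y in 𝓝 x, ∀ μ ν, g.val y (e' μ y) (e ν y) = if μ = ν then 1 else 0)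
    (μ : Fin (Module.finrank ℝ E)) (v : TangentSpace 𝓘(ℝ, E) x) :
    nabla (e' μ) x v = -∑ ρ, g.val x (e' μ x) (nabla (e ρ) x v) • e' ρ x := by
  rw [← g.sum_val_smul_of_dual' h.self_of_nhds (nabla (e' μ) x v), ← Finset.sum_neg_distrib]
  refine Finset.sum_congr rfl fun ρ _ ↦ ?_
  have h1 := hnabla.2 (e' μ) (e ρ) x ((he' μ).mdifferentiable (by simp) x)
    ((he ρ).mdifferentiable (by simp) x) v
  have h2 : (fun y ↦ g.val y (e' μ y) (e ρ y)) =ᶠ[𝓝 x] fun _ ↦ if μ = ρ then (1 : ℝ) else 0 :=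
    h.mono fun y hy ↦ hy μ ρ
  rw [mvfderiv_congr h2, mvfderiv_const, zero_apply] at h1
  rw [← neg_smul]
  congr 1
  linarith

theorem eq_coframe_of_dual {x : M} {e' : Fin (Module.finrank ℝ E) → TangentSpace 𝓘(ℝ, E) x}
    (h : ∀ μ ν, g.val x (e' μ) (PseudoRiemannianMetric.frame x ν) = if μ = ν then 1 else 0)
    (μ : Fin (Module.finrank ℝ E)) : e' μ = g.coframe x μ := by
  rw [← g.sum_val_smul_of_dual' (g.val_coframe_frame x) (e' μ)]
  simp [h]

/-- The square of `γ^μ η ⊗ D_μ`, on a section with derivatives `L`. -/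
theorem imathFun_imathFun_eq [T2Space M] (hnabla : g.IsLeviCivita nabla)
    (hη : ContMDiff 𝓘(ℝ, E) (𝓘(ℝ, E).prod 𝓘(ℝ, F)) ∞ (T% η))
    (hparallel : ∀ x, C.conj D η x = 0) {x : M}
    {e e' : Fin (Module.finrank ℝ E) → Π y : M, TangentSpace 𝓘(ℝ, E) y}
    (he : ∀ μ, ContMDiff 𝓘(ℝ, E) (𝓘(ℝ, E).prod 𝓘(ℝ, E)) ∞ (T% (e μ)))
    (he' : ∀ μ, ContMDiff 𝓘(ℝ, E) (𝓘(ℝ, E).prod 𝓘(ℝ, E)) ∞ (T% (e' μ)))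
    (hex : ∀ μ, e μ x = PseudoRiemannianMetric.frame x μ)
    (h : ∀ᶠ y in 𝓝 x, ∀ μ ν, g.val y (e' μ y) (e ν y) = if μ = ν then 1 else 0)
    {α : Π y : M, ExteriorAlgebra 𝕜 (S y)}
    {L : Π y : M, TangentSpace 𝓘(ℝ, E) y →ₗ[ℝ] ExteriorAlgebra 𝕜 (S y)}
    (hL : ∀ y v, superDeriv D y v α = L y v)
    (hL' : ∀ μ, (fun y ↦ L y (e μ y)) ∈ SuperFunctions 𝕜 E F S) :
    imathFun γ D η (imathFun γ D η α) x
      = g.contract x (fun v w ↦ torsionForm D η C nabla x v * L x w)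
        + (2⁻¹ : 𝕜) • ∑ ν, ∑ ρ, γ.mulι (η x) (g.coframe x ν) * γ.mulι (η x) (g.coframe x ρ)
          * (superDeriv D x (e ν x) (fun y ↦ L y (e ρ y))
            - superDeriv D x (e ρ x) (fun y ↦ L y (e ν y))
            - L x (VectorField.mlieBracket 𝓘(ℝ, E) (e ν) (e ρ) x)) := by
  have hdual : ∀ μ, e' μ x = g.coframe x μ := by
    refine eq_coframe_of_dual fun μ ν ↦ ?_
    rw [← hex ν]
    exact h.self_of_nhds μ ν
  have hb (μ) : ContMDiff 𝓘(ℝ, E) (𝓘(ℝ, E).prod 𝓘(ℝ, F)) ∞ (T% fun y ↦ γ.mul y (e' μ y) (η y)) :=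
    γ.contMDiff_mul_apply (he' μ) hη
  -- Product rule for the Clifford multiplication; the derivative of `η` drops out because `D^C η =
  -- 0`, and the derivative of the dual frame is rewritten through that of the frame.
  have hDb (μ) (v : TangentSpace 𝓘(ℝ, E) x) : ExteriorAlgebra.ι 𝕜
      (D.toFun (fun y ↦ γ.mul y (e' μ y) (η y)) x v)
      = ExteriorAlgebra.ι 𝕜 (hatD C D nabla x v (e' μ x) (η x))
        - ∑ ρ, g.val x (e' μ x) (nabla (e ρ) x v) • γ.mulι (η x) (e' ρ x) := by
    have h1 := hatD_apply C D nabla v ((he' μ).mdifferentiable (by simp) x)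
      (hη.mdifferentiable (by simp) x)
    rw [hparallel, zero_apply, map_zero, sub_zero, eq_sub_iff_add_eq] at h1
    rw [← h1, map_add, ← γ.mulι_apply, nabla_dual_frame hnabla he he' h, map_neg, map_sum,
      ← sub_eq_add_neg]
    simp only [map_smul]
  -- This is the covariant Hessian of `α`; its correction term collects what the derivatives of the
  -- dual frame contribute.
  set N : Fin (Module.finrank ℝ E) → Fin (Module.finrank ℝ E) → ExteriorAlgebra 𝕜 (S x) :=
    fun ν ρ ↦ superDeriv D x (e ν x) (fun y ↦ L y (e ρ y)) - L x (nabla (e ρ) x (e ν x)) with hN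
  set b : Fin (Module.finrank ℝ E) → ExteriorAlgebra 𝕜 (S x) :=
    fun ν ↦ γ.mulι (η x) (g.coframe x ν) with hbdef
  have hswap (ν ρ) : b ν * b ρ = -(b ρ * b ν) := exteriorAlgebra_ι_mul_swap _ _
  have key : imathFun γ D η (imathFun γ D η α) x
      = g.contract x (fun v w ↦ torsionForm D η C nabla x v * L x w)
        + ∑ ν, ∑ ρ, b ν * b ρ * N ν ρ := by
    have h1 : ∀ᶠ y in 𝓝 x, imathFun γ D η α y
        = (∑ μ, (fun y ↦ ExteriorAlgebra.ι 𝕜 (γ.mul y (e' μ y) (η y))) * fun y ↦ L y (e μ y)) y :=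
      h.mono fun y hy ↦ by
        rw [imathFun_eq_sum hy (hL y), Finset.sum_apply]
        rfl
    have h2 (μ) (v : TangentSpace 𝓘(ℝ, E) x) := superDeriv_mul (D := D)
      (superDeriv_spinor (D := D) ((hb μ).mdifferentiable (by simp) x) v).1
      (superDiffAt_of_mem D x (hL' μ)) v
    have h3 (ν) : superDeriv D x (e ν x) (∑ μ, (fun y ↦ ExteriorAlgebra.ι 𝕜
        (γ.mul y (e' μ y) (η y))) * fun y ↦ L y (e μ y))
        = ∑ μ, ExteriorAlgebra.ι 𝕜 (hatD C D nabla x (e ν x) (e' μ x) (η x)) * L x (e μ x)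
          + ∑ ρ, b ρ * N ν ρ := by
      rw [(superDeriv_sum Finset.univ (fun μ ↦ (h2 μ (e ν x)).1) (e ν x)).2]
      -- The connection coefficients are moved from the coefficients `γ^ρ η` to the argument of `L`
      -- by expanding `∇ e_ρ` in the frame.
      have h4 : ∑ ρ, b ρ * L x (nabla (e ρ) x (e ν x)) = ∑ μ, (∑ ρ,
          g.val x (e' μ x) (nabla (e ρ) x (e ν x)) • γ.mulι (η x) (e' ρ x)) * L x (e μ x) := by
        simp only [Finset.sum_mul]
        rw [Finset.sum_comm]
        refine Finset.sum_congr rfl fun ρ _ ↦ ?_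
        conv_lhs => rw [← g.sum_val_smul_of_dual h.self_of_nhds (nabla (e ρ) x (e ν x))]
        rw [map_sum, Finset.mul_sum]
        refine Finset.sum_congr rfl fun μ _ ↦ ?_
        rw [map_smul, mul_smul_comm, smul_mul_assoc, hdual ρ]
      simp only [hN, mul_sub, Finset.sum_sub_distrib]
      rw [h4, ← add_sub_assoc, ← Finset.sum_add_distrib, ← Finset.sum_sub_distrib]
      refine Finset.sum_congr rfl fun μ _ ↦ ?_
      rw [(h2 μ (e ν x)).2, (superDeriv_spinor ((hb μ).mdifferentiable (by simp) x) _).2, hDb,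
        sub_mul, hbdef]
      simp only [← hdual, γ.mulι_apply]
      abel
    rw [imathFun_congr h1, imathFun, PseudoRiemannianMetric.contract]
    simp only [← hex, h3, mul_add, Finset.sum_add_distrib]
    congr 1
    · simp only [PseudoRiemannianMetric.contract, torsionForm_apply, Finset.mul_sum,
        Finset.sum_mul, ← mul_assoc, ← hdual, ← hex]
      rw [Finset.sum_comm]
    · simp only [Finset.mul_sum, ← mul_assoc]
      rfl
  rw [key]
  congr 1
  -- Since the `b ν` anticommute, exchanging the indices of `N` changes the sign of the sum. Hence
  -- only the skew part counts, which explains the factor `2⁻¹`.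
  have h5 : ∑ ν, ∑ ρ, b ν * b ρ * N ρ ν = -∑ ν, ∑ ρ, b ν * b ρ * N ν ρ := by
    rw [Finset.sum_comm, ← Finset.sum_neg_distrib]
    refine Finset.sum_congr rfl fun ρ _ ↦ ?_
    rw [← Finset.sum_neg_distrib]
    refine Finset.sum_congr rfl fun ν _ ↦ ?_
    rw [hswap ν ρ, neg_mul]
  -- Torsion freeness: the skew part of the Hessian is the commutator of derivatives minus the
  -- derivative along the bracket.
  have h6 (ν ρ) : superDeriv D x (e ν x) (fun y ↦ L y (e ρ y))
      - superDeriv D x (e ρ x) (fun y ↦ L y (e ν y))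
      - L x (VectorField.mlieBracket 𝓘(ℝ, E) (e ν) (e ρ) x) = N ν ρ - N ρ ν := by
    rw [← hnabla.1 (e ν) (e ρ) x ((he ν).mdifferentiable (by simp) x)
      ((he ρ).mdifferentiable (by simp) x), map_sub]
    exact sub_sub_sub_comm _ _ _ _
  simp only [h6, mul_sub, Finset.sum_sub_distrib]
  change _ = (2⁻¹ : 𝕜) • (∑ ν, ∑ ρ, b ν * b ρ * N ν ρ - ∑ ν, ∑ ρ, b ν * b ρ * N ρ ν)
  rw [h5, sub_neg_eq_add, ← two_smul 𝕜, smul_smul, inv_mul_cancel₀ two_ne_zero, one_smul]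

end Square

/-! ### The square on functions and spinors, and the torsion field -/

section Main

variable {𝕜 : Type*} [RCLike 𝕜]
  {E : Type*} [NormedAddCommGroup E] [NormedSpace ℝ E] [FiniteDimensional ℝ E]
  {M : Type*} [TopologicalSpace M] [ChartedSpace E M] [IsManifold 𝓘(ℝ, E) ∞ M]
  {F : Type*} [NormedAddCommGroup F] [NormedSpace ℝ F] [NormedSpace 𝕜 F] [IsScalarTower ℝ 𝕜 F]
  [FiniteDimensional ℝ F] [FiniteDimensional 𝕜 F]
  {S : M → Type*} [TopologicalSpace (TotalSpace F S)]
  [∀ x, AddCommGroup (S x)] [∀ x, Module ℝ (S x)] [∀ x, Module 𝕜 (S x)]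
  [∀ x, IsScalarTower ℝ 𝕜 (S x)]
  [∀ x, TopologicalSpace (S x)] [∀ x, IsTopologicalAddGroup (S x)] [∀ x, ContinuousSMul ℝ (S x)]
  [FiberBundle F S] [VectorBundle ℝ F S] [VectorBundle 𝕜 F S]
  [ContMDiffVectorBundle ∞ F S 𝓘(ℝ, E)]

  {g : PseudoRiemannianMetric E M}
  {γ : CliffordMultiplication 𝕜 g F S} {D : SpinorConnection 𝕜 E F S} {η : Π x : M, S x}
  {C : ChargeConjugation γ}
  {nabla : CovariantDerivative 𝓘(ℝ, E) E (TangentSpace 𝓘(ℝ, E) : M → Type _)}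

/-- The curvature term is absent on functions, where the bracket acts as the commutator
(`mvfderiv_mlieBracket`). -/
theorem imathFun_imathFun_function [T2Space M] (hnabla : g.IsLeviCivita nabla)
    (hη : ContMDiff 𝓘(ℝ, E) (𝓘(ℝ, E).prod 𝓘(ℝ, F)) ∞ (T% η))
    (hparallel : ∀ x, C.conj D η x = 0) {f : M → 𝕜} (hf : ContMDiff 𝓘(ℝ, E) 𝓘(ℝ, 𝕜) ∞ f) (x : M) :
    imathFun γ D η (imathFun γ D η fun y ↦ algebraMap 𝕜 (ExteriorAlgebra 𝕜 (S y)) (f y)) x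
      = g.contract x fun v w ↦ torsionForm D η C nabla x v
        * algebraMap 𝕜 (ExteriorAlgebra 𝕜 (S x)) (mvfderiv 𝓘(ℝ, E) f x w) := by
  obtain ⟨e, e', he, he', hex, h⟩ := g.exists_dual_frame x
  have hd (μ) : ContMDiff 𝓘(ℝ, E) 𝓘(ℝ, 𝕜) ∞ fun y ↦ mvfderiv 𝓘(ℝ, E) f y (e μ y) :=
    contMDiff_mvfderiv_apply hf (he μ)
  rw [imathFun_imathFun_eq hnabla hη hparallel he he' (fun μ ↦ by simp [(hex μ).self_of_nhds]) h
    (L := derivFunction f) (fun y v ↦ (superDeriv_function (hf.mdifferentiable (by simp) y) v).2)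
    fun μ ↦ (ofFunction _ (hd μ)).2]
  refine add_eq_left.2 ?_
  rw [Finset.sum_eq_zero fun ν _ ↦ Finset.sum_eq_zero fun ρ _ ↦ ?_, smul_zero]
  have h1 (μ ν) : superDeriv D x (e ν x) (fun y ↦ derivFunction (S := S) f y (e μ y))
      = algebraMap 𝕜 (ExteriorAlgebra 𝕜 (S x))
        (mvfderiv 𝓘(ℝ, E) (fun y ↦ mvfderiv 𝓘(ℝ, E) f y (e μ y)) x (e ν x)) :=
    (superDeriv_function ((hd μ).mdifferentiable (by simp) x) _).2
  have h2 : derivFunction (S := S) f x (VectorField.mlieBracket 𝓘(ℝ, E) (e ν) (e ρ) x)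
      = algebraMap 𝕜 _ (mvfderiv 𝓘(ℝ, E) f x _) := rfl
  rw [h1, h1, h2, mvfderiv_mlieBracket hf (he ν) (he ρ), map_sub, sub_self, mul_zero]

theorem imathFun_imathFun_spinor [T2Space M] (hnabla : g.IsLeviCivita nabla)
    (hη : ContMDiff 𝓘(ℝ, E) (𝓘(ℝ, E).prod 𝓘(ℝ, F)) ∞ (T% η))
    (hparallel : ∀ x, C.conj D η x = 0) {ψ : Π y : M, S y}
    (hψ : ContMDiff 𝓘(ℝ, E) (𝓘(ℝ, E).prod 𝓘(ℝ, F)) ∞ (T% ψ)) (x : M) :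
    imathFun γ D η (imathFun γ D η fun y ↦ ExteriorAlgebra.ι 𝕜 (ψ y)) x
      = g.contract x (fun v w ↦ torsionForm D η C nabla x v
        * ExteriorAlgebra.ι 𝕜 (D.toFun ψ x w)) + (2⁻¹ : 𝕜) • fieldB γ D η η x (ψ x) := by
  obtain ⟨e, e', he, he', hex, h⟩ := g.exists_dual_frame x
  have hd (μ) : ContMDiff 𝓘(ℝ, E) (𝓘(ℝ, E).prod 𝓘(ℝ, F)) ∞ (T% fun y ↦ D.toFun ψ y (e μ y)) :=
    D.contMDiff_apply hψ (he μ)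
  rw [imathFun_imathFun_eq hnabla hη hparallel he he' (fun μ ↦ by simp [(hex μ).self_of_nhds]) h
    (L := derivSpinor D ψ) (fun y v ↦ (superDeriv_spinor (hψ.mdifferentiable (by simp) y) v).2)
    fun μ ↦ (ofSpinor _ (hd μ)).2]
  refine congrArg₂ _ rfl (congrArg _ ?_)
  refine Finset.sum_congr rfl fun ν _ ↦ Finset.sum_congr rfl fun ρ _ ↦ ?_
  have h1 (μ ν) : superDeriv D x (e ν x) (fun y ↦ derivSpinor D ψ y (e μ y))
      = ExteriorAlgebra.ι 𝕜 (D.toFun (fun y ↦ D.toFun ψ y (e μ y)) x (e ν x)) :=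
    (superDeriv_spinor ((hd μ).mdifferentiable (by simp) x) _).2
  have h2 : derivSpinor D ψ x (VectorField.mlieBracket 𝓘(ℝ, E) (e ν) (e ρ) x)
      = ExteriorAlgebra.ι 𝕜 (D.toFun ψ x _) := rfl
  -- The frame agrees near `x`, and not only at `x`, with the extensions that define `curvature`, so
  -- the brackets also agree.
  have h3 := D.curvatureOp_eq_curvature (he ν) (he ρ) (hex ν) (hex ρ) hψ
  rw [h1, h1, h2, ← map_sub, ← map_sub]
  exact congrArg (fun s ↦ _ * ExteriorAlgebra.ι 𝕜 s) h3

/-- On `η` admissibility makes `D̂γ` skew, so the torsion is `2 D̂γ`. The two summands of `𝔇`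
coincide when `φ = ψ = η`, which gives a total factor `4`. As the dual frame is a basis, the tensor
vanishes only if all its coefficients do. -/
theorem fieldD_eq_zero_iff (hadm : IsAdmissible C D nabla {η}) (x : M) :
    fieldD C D nabla η η x = 0 ↔ torsionForm D η C nabla x = 0 := by
  have h1 (v w : TangentSpace 𝓘(ℝ, E) x) :
      torsion C D nabla x v w (η x) = (2 : 𝕜) • hatD C D nabla x v w (η x) := by
    rw [torsion, eq_neg_of_add_eq_zero_right (hadm η rfl x v w), sub_neg_eq_add, two_smul]
  have h2 : fieldD C D nabla η η x = ∑ ν, ((4 : 𝕜) • torsionForm D η C nabla x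
      (PseudoRiemannianMetric.frame x ν)) ⊗ₜ[ℝ] g.coframe x ν := by
    rw [fieldD, PseudoRiemannianMetric.contract]
    refine Finset.sum_congr rfl fun ν _ ↦ ?_
    congr 1
    rw [torsionForm_apply, Finset.smul_sum]
    refine Finset.sum_congr rfl fun μ _ ↦ ?_
    beta_reduce
    rw [h1, map_smul, mul_smul_comm, ← add_smul, γ.mulι_apply]
    norm_num
  constructor
  · intro h
    rw [h2] at h
    refine (PseudoRiemannianMetric.frame x).ext fun ν ↦ ?_
    have h3 := TensorProduct.sum_tmul_basis_right_eq_zero (g.coframe x)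
      (Finsupp.equivFunOnFinite.symm fun ν ↦ (4 : 𝕜) • torsionForm D η C nabla x
        (PseudoRiemannianMetric.frame x ν))
      (by rw [Finsupp.sum_fintype _ _ (by simp)]; exact h)
    have h4 := DFunLike.congr_fun h3 ν
    exact (smul_eq_zero.1 h4).resolve_left (by norm_num)
  · intro h
    simp [h2, h]

end Main

end SpinSuper

end

/-! ### The differential condition versus flatness -/

theorem proposition5p4 {𝕜 : Type*} [RCLike 𝕜]
    {E : Type*} [NormedAddCommGroup E] [NormedSpace ℝ E] [FiniteDimensional ℝ E]
    {M : Type*} [TopologicalSpace M] [T2Space M] [ChartedSpace E M] [IsManifold 𝓘(ℝ, E) ∞ M]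
    {F : Type*} [NormedAddCommGroup F] [NormedSpace ℝ F] [NormedSpace 𝕜 F] [IsScalarTower ℝ 𝕜 F]
    [FiniteDimensional ℝ F]
    {S : M → Type*} [TopologicalSpace (TotalSpace F S)]
    [∀ x, AddCommGroup (S x)] [∀ x, Module ℝ (S x)] [∀ x, Module 𝕜 (S x)]
    [∀ x, IsScalarTower ℝ 𝕜 (S x)]
    [∀ x, TopologicalSpace (S x)] [∀ x, IsTopologicalAddGroup (S x)] [∀ x, ContinuousSMul ℝ (S x)]
    [FiberBundle F S] [VectorBundle ℝ F S] [VectorBundle 𝕜 F S]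
    [ContMDiffVectorBundle ∞ F S 𝓘(ℝ, E)]
    (g : PseudoRiemannianMetric E M)
    (nabla : CovariantDerivative 𝓘(ℝ, E) E (TangentSpace 𝓘(ℝ, E) : M → Type _))
    (hnabla : g.IsLeviCivita nabla)
    (γ : CliffordMultiplication 𝕜 g F S) (C : ChargeConjugation γ)
    (D : SpinorConnection 𝕜 E F S)
    (η : Π x : M, S x) (hη : ContMDiff 𝓘(ℝ, E) (𝓘(ℝ, E).prod 𝓘(ℝ, F)) ∞ (T% η))
    (hparallel : ∀ x, C.conj D η x = 0)
    (hadm : IsAdmissible C D nabla {η}) :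
    (∃! Q : OddVectorField 𝕜 E F S, IsImath γ D η Q) ∧
    ∀ Q : OddVectorField 𝕜 E F S, IsImath γ D η Q →
      (Q.IsDifferential ↔ IsFlat C D nabla {η}) := by

  have : FiniteDimensional 𝕜 F := Module.Finite.of_restrictScalars_finite ℝ 𝕜 F
  refine ⟨⟨imath γ D hη, isImath_imath hη, fun Q hQ ↦ hQ.eq_imath hη⟩, fun Q hQ ↦ ?_⟩
  rw [hQ.eq_imath hη]
  constructor
  · intro h
    have htorsion (x : M) : torsionForm D η C nabla x = 0 := by
      ext v
      -- The test function has differential `g(v, ·)` at `x`, so that contracting `torsionForm` with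
      -- it returns the value at `v`.
      obtain ⟨f, hf, hfx⟩ := exists_contMDiff_mvfderiv_eq x (g.val x v)
      have hf' : ContMDiff 𝓘(ℝ, E) 𝓘(ℝ, 𝕜) ∞ fun y ↦ (f y : 𝕜) :=
        (RCLike.ofRealCLM (K := 𝕜)).contMDiff.comp hf
      have h1 := congrArg (fun α ↦ α.1 x) (h (ofFunction _ hf'))
      have h2 := (imathFun_imathFun_function (γ := γ) (D := D) hnabla hη hparallel hf' x).symm.trans
        h1
      have h3 (w : TangentSpace 𝓘(ℝ, E) x) : mvfderiv 𝓘(ℝ, E) (fun y ↦ (f y : 𝕜)) x w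
          = (g.val x v w : ℝ) :=
        (mvfderiv_clm_comp (RCLike.ofRealCLM (K := 𝕜)) (hf.mdifferentiable (by simp) x) w).trans
          (by rw [hfx]; rfl)
      have h4 : g.contract x (fun u w ↦ torsionForm D η C nabla x u
          * algebraMap 𝕜 (ExteriorAlgebra 𝕜 (S x)) (mvfderiv 𝓘(ℝ, E) (fun y ↦ (f y : 𝕜)) x w))
          = torsionForm D η C nabla x v := by
        conv_rhs => rw [← g.sum_val_smul_of_dual' (g.val_coframe_frame x) v]
        rw [map_sum]
        refine Finset.sum_congr rfl fun μ _ ↦ ?_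
        beta_reduce
        rw [h3, map_smul, ← Algebra.commutes, ← Algebra.smul_def]
        exact algebraMap_smul 𝕜 _ _
      exact h4.symm.trans h2
    rintro φ rfl ψ rfl
    refine ⟨fun x s ↦ ?_, fun x ↦ (fieldD_eq_zero_iff hadm x).2 (htorsion x)⟩
    -- The spinor `s` is the value of a smooth section; with the torsion term gone, the square on
    -- that section is half of `𝔅` applied to `s`.
    obtain ⟨ψ, hψ, -, hs⟩ := exists_contMDiff_section_apply_eq (E := E) (F := F) s
    have h1 := congrArg (fun α ↦ α.1 x) (h (ofSpinor _ hψ))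
    have h2 := (imathFun_imathFun_spinor (γ := γ) (D := D) hnabla hη hparallel hψ x).symm.trans h1
    simp only [htorsion, PseudoRiemannianMetric.contract, LinearMap.zero_apply, zero_mul,
      Finset.sum_const_zero, zero_add, hs] at h2
    exact (smul_eq_zero.1 h2).resolve_left (inv_ne_zero (two_ne_zero (α := 𝕜)))
  · intro h
    obtain ⟨hB, hD⟩ := h η rfl η rfl
    have htorsion (x : M) : torsionForm D η C nabla x = 0 := (fieldD_eq_zero_iff hadm x).1 (hD x)
    refine imath_isDifferential hη (fun f hf x ↦ ?_) fun ψ hψ x ↦ ?_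
    · rw [imathFun_imathFun_function hnabla hη hparallel hf]
      simp [htorsion, PseudoRiemannianMetric.contract]
    · rw [imathFun_imathFun_spinor hnabla hη hparallel hψ, hB]
      simp [htorsion, PseudoRiemannianMetric.contract]
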